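/- Let $\mathcal X\subset\mathbb C$ be a finite non-empty constellation with zero mean, $\sum_{x\in\mathcal X}x=0$, and average symbol energy $E_{\mathrm s}=\frac1{|\mathcal X|}\sum_{x\in\mathcal X}|x|^2$, and let $\sigma_{\mathrm p}^2,N_0\ge 0$. For $N=2^\ell$ let $s=(s_1,\dots,s_N)^T$ have i.i.d. components uniform on $\mathcal X$, let $\theta_1,\dots,\theta_N$ be i.i.d. real Gaussian with mean zero and variance $\sigma_{\mathrm p}^2$, and let $n=(n_1,\dots,n_N)^T$ have i.i.d. circularly symmetric complex Gaussian components of variance $N_0$; let $s$, $(\theta_k)_k$ and $n$ be independent, and put $\Theta=\mathrm{diag}(e^{j\theta_1},\dots,e^{j\theta_N})$. Let $g:\mathbb C^N\to\mathbb R^{2N}$, $g(z)=(\Re z_1,\Im z_1,\dots,\Re z_N,\Im z_N)^T$, and, for a real $2N\times 2N$ matrix $\mathsf R$, let $f_{\mathsf R}(z)=g^{-1}(\mathsf R\,g(z))$. The Hadamard matrices are $$\mathsf H_1=1,\qquad \mathsf H_2=\frac1{\sqrt2}\begin{bmatrix}1&1\\-1&1\end{bmatrix},\qquad \mathsf H_{2^\ell}=\mathsf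 H_2\otimes\mathsf H_{2^{\ell-1}}.$$ Let $\mathsf R$ be a Hadamard rotation, either on the real-component basis, $\mathsf R=\mathsf H_{2N}$, or on the complex-signal basis, $\mathsf R=\mathsf H_N\otimes\mathsf I_2$ (so that $f_{\mathsf R}(s)=\mathsf H_Ns$). Let $$r=\Theta f_{\mathsf R}(s)+n,\qquad \tilde r=f_{\mathsf R^T}(r)$$ be the received and the derotated received signal. Then, as $N=2^\ell\to\infty$, the signal in each channel becomes $\tilde r_i=\alpha s_i+\tilde n_i$ with $\alpha=e^{-\sigma_{\mathrm p}^2/2}$, in the following sense: for every choice of channels $i=i_N\in\{1,\dots,N\}$, the pair $(s_i,\tilde r_i)$ converges in distribution to $(\mathbf s,\alpha\mathbf s+\tilde{\mathbf n})$, where $\mathbf s$ is uniform on $\mathcal X$ and $\tilde{\mathbf n}$ is independent of $\mathbf s$ and zero-mean complex Gaussian (real and imaginary parts jointly Gaussian) with variance $$\mathbb E|\tilde{\mathbf n}|^2=N_0+E_{\mathrm s}\bigl(1-e^{-\sigma_{\mathrm p}^2}\bigr);$$ its law does not depend on the choice of channels or of the two kinds of Hadamard rotation. If $\mathcal X$ is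 a standard QAM format, i.e. up to a non-zero complex factor a square constellation $\{x+jy:\ x,y\in\{-(m-1),-(m-3),\dots,m-1\}\}$, $m\ge2$, or a cross constellation with $32c^2$ points, $c\ge1$ (the square constellation with $m=6c$ without a $c\times c$ block of points at each of its four corners), then $\tilde{\mathbf n}$ is circularly symmetric. -/

import Mathlib

open MeasureTheory ProbabilityTheory Filter
open scoped NNReal Kronecker

noncomputable section

/-! ### Rotations on a real-component basis and Hadamard rotations -/

/-- `[z₁, …, z_N] ↦ [Re z₁, Im z₁, …, Re z_N, Im z_N]`: with indices counted from zero, the entry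
`2 i` is `Re (z i)` and the entry `2 i + 1` is `Im (z i)`. -/
def toRealComponents {N : ℕ} (z : Fin N → ℂ) : Fin (N * 2) → ℝ := fun k =>
  if (finProdFinEquiv.symm k).2 = 0 then (z (finProdFinEquiv.symm k).1).re
  else (z (finProdFinEquiv.symm k).1).im

/-- `[x₁, …, x_{2N}] ↦ [x₁ + j x₂, …, x_{2N-1} + j x_{2N}]`. -/
def ofRealComponents {N : ℕ} (x : Fin (N * 2) → ℝ) : Fin N → ℂ := fun i =>
  (x (finProdFinEquiv (i, 0)) : ℂ) + (x (finProdFinEquiv (i, 1)) : ℂ) * Complex.I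

/-- The map `f_R` applying the real `2N × 2N` matrix `R` to a complex signal in `N` channels. -/
def rotateSignal {N : ℕ} (R : Matrix (Fin (N * 2)) (Fin (N * 2)) ℝ) (z : Fin N → ℂ) : Fin N → ℂ :=
  ofRealComponents (R.mulVec (toRealComponents z))

/-- The Hadamard rotation of order two. -/
def hadamardTwo : Matrix (Fin 2) (Fin 2) ℝ :=
  (1 / Real.sqrt 2) • !![1, 1; -1, 1]

/-- The Hadamard rotation of order `2 ^ ℓ`, by `H_1 = 1` and `H_{2^(ℓ+1)} = H_2 ⊗ H_{2^ℓ}`; the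
pair of indices `(a, b)` of the Kronecker product is the index `b + 2 ^ ℓ * a`. -/
def hadamard : (ℓ : ℕ) → Matrix (Fin (2 ^ ℓ)) (Fin (2 ^ ℓ)) ℝ
  | 0 => 1
  | ℓ + 1 =>
    Matrix.reindex (finProdFinEquiv.trans (finCongr (pow_succ' 2 ℓ).symm))
      (finProdFinEquiv.trans (finCongr (pow_succ' 2 ℓ).symm)) (hadamardTwo ⊗ₖ hadamard ℓ)

/-- The Hadamard rotation `H_{2N}` acting on the `2N` real components of `N = 2 ^ ℓ` channels. -/
def hadamardRealBasis (ℓ : ℕ) : Matrix (Fin (2 ^ ℓ * 2)) (Fin (2 ^ ℓ * 2)) ℝ :=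
  Matrix.reindex (finCongr (pow_succ 2 ℓ)) (finCongr (pow_succ 2 ℓ)) (hadamard (ℓ + 1))

/-- The Hadamard rotation `H_N ⊗ I_2`, for `N = 2 ^ ℓ`, which acts as `H_N` on the complex
signal. -/
def hadamardComplexBasis (ℓ : ℕ) : Matrix (Fin (2 ^ ℓ * 2)) (Fin (2 ^ ℓ * 2)) ℝ :=
  Matrix.reindex finProdFinEquiv finProdFinEquiv
    (hadamard ℓ ⊗ₖ (1 : Matrix (Fin 2) (Fin 2) ℝ))

/-- A Hadamard rotation of the signals in `2 ^ ℓ` channels. -/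
def IsHadamardRotation (ℓ : ℕ) (R : Matrix (Fin (2 ^ ℓ * 2)) (Fin (2 ^ ℓ * 2)) ℝ) : Prop :=
  R = hadamardRealBasis ℓ ∨ R = hadamardComplexBasis ℓ

/-! ### Complex Gaussian laws -/

/-- `ν` is a zero-mean complex Gaussian law (the real and the imaginary part are jointly Gaussian,
possibly degenerate) with variance `E|z|² = v`. -/
structure IsComplexGaussian (ν : Measure ℂ) (v : ℝ) : Prop where
  isGaussian : IsGaussian ν
  mean_eq : ∫ z, z ∂ν = 0
  variance_eq : ∫ z, ‖z‖ ^ 2 ∂ν = v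

/-- The law `ν` on the complex plane is invariant under all rotations about the origin. -/
def IsCircularlySymmetric (ν : Measure ℂ) : Prop :=
  ∀ φ : ℝ, ν.map (fun z => Complex.exp (φ * Complex.I) * z) = ν

/-! ### Constellations -/

/-- The points `x + j y` with `x, y ∈ {-(m-1), -(m-3), …, m-3, m-1}`. -/
def squareQAM (m : ℕ) : Finset ℂ :=
  (Finset.univ : Finset (Fin m × Fin m)).image fun p =>
    ((2 * (p.1 : ℕ) - (m - 1) : ℝ) : ℂ) + ((2 * (p.2 : ℕ) - (m - 1) : ℝ) : ℂ) * Complex.I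

/-- The cross constellation with `32 c ^ 2` points: the square constellation with `(6 c) ^ 2`
points without a `c × c` block at each of its four corners. -/
def crossQAM (c : ℕ) : Finset ℂ :=
  (squareQAM (6 * c)).filter fun z => |z.re| < 4 * c ∨ |z.im| < 4 * c

/-- `X` is a square or a cross QAM constellation, up to scaling and rotation of the plane. -/
def IsStandardQAM (X : Finset ℂ) : Prop :=
  ∃ a : ℂ, a ≠ 0 ∧
    ((∃ m : ℕ, 2 ≤ m ∧ X = (squareQAM m).image fun z => a * z) ∨
      ∃ c : ℕ, 1 ≤ c ∧ X = (crossQAM c).image fun z => a * z)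

/-! ### The channel model -/

/-- The probabilistic assumptions in `N` channels: the data symbols `s k` are i.i.d. uniform on the
constellation `X`, the phase noises `θ k` are i.i.d. real Gaussian with mean zero and variance
`σp2`, the additive noises `n k` are i.i.d. circularly symmetric complex Gaussian with variance
`N0`, and symbols, phase noise and additive noise are independent. -/
structure IsPhaseNoiseModel (X : Finset ℂ) (σp2 N0 : ℝ≥0) {Ω : Type*} [MeasurableSpace Ω]
    (P : Measure Ω) {N : ℕ} (s : Fin N → Ω → ℂ) (θ : Fin N → Ω → ℝ) (n : Fin N → Ω → ℂ) :
    Prop where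
  symbol_law : ∀ k, HasLaw (s k) (uniformOn (X : Set ℂ)) P
  symbol_indep : iIndepFun s P
  phase_law : ∀ k, HasLaw (θ k) (gaussianReal 0 σp2) P
  phase_indep : iIndepFun θ P
  noise_gaussian : ∀ k, IsComplexGaussian (P.map (n k)) N0
  noise_circular : ∀ k, IsCircularlySymmetric (P.map (n k))
  noise_indep : iIndepFun n P
  symbol_indep_rest : IndepFun (fun ω k => s k ω) (fun ω => (fun k => θ k ω, fun k => n k ω)) P
  phase_indep_noise : IndepFun (fun ω k => θ k ω) (fun ω k => n k ω) P

/-- The received signal `r = Θ f_R(s) + n` with `Θ = diag(e^{jθ₁}, …, e^{jθ_N})`. -/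
def receivedSignal {N : ℕ} (R : Matrix (Fin (N * 2)) (Fin (N * 2)) ℝ) (s : Fin N → ℂ)
    (θ : Fin N → ℝ) (n : Fin N → ℂ) : Fin N → ℂ :=
  (Matrix.diagonal fun k => Complex.exp (θ k * Complex.I)).mulVec (rotateSignal R s) + n

/-- The derotated received signal `f_{Rᵀ}(r)`. -/
def derotatedSignal {N : ℕ} (R : Matrix (Fin (N * 2)) (Fin (N * 2)) ℝ) (s : Fin N → ℂ)
    (θ : Fin N → ℝ) (n : Fin N → ℂ) : Fin N → ℂ :=
  rotateSignal R.transpose (receivedSignal R s θ n)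

end

/-! Both Hadamard rotations act as `c • H_N` on the complex signal with `‖c‖ = 1`. The scalar
commutes with the diagonal phases and cancels on derotation, so by
`IsHadamardRotation.exists_derotatedSignal_eq` the signal part of channel `i` is `∑ k, H k i *
e^{jθ_k} * (H s)_k`, and only a unit factor remains on the additive noise.

Condition on `s`. The sum then has independent terms, and its characteristic function at `b` is a
product of characteristic functions of `e^{jθ}`. Replace each factor by the Gaussian one with the
same mean and variance. The means add up to exactly `α s_i`, because `Hᵀ H = 1`. For the variances,
the squared entries are `1 / N`, and by Parseval (`sum_phaseVariance_eq`) the sum over the rotated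
symbols `(H s)_k` equals the sum over the original ones. The conditional variance is thus an
empirical mean over i.i.d. symbols, so no limit theorem for `H s` is needed. The weak law
`integral_abs_average_sub_le` replaces this mean by a constant; a constant variance is what makes
the limiting noise independent of the symbol.

The cost of the Gaussian replacement is a multiple of `N^{-3/2} ∑ k, ‖(H s)_k‖ ^ 3`. Its expectation
is `O(N^{-1/2})` since `integral_norm_sum_pow_three_le` bounds the third moments uniformly. Zero
mean of the constellation enters here: the constant row of `H` would otherwise produce an entry of
order `√N`. Altogether `norm_integral_charFun_sub_le` gives an error `O(1 / √N)`, uniform in the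
channel, and Lévy's theorem for the pair concludes.

The limiting noise is built in `exists_isComplexGaussian_phaseVariance`. For QAM, invariance of the
constellation under multiplication by `I` already makes its covariance a multiple of the identity.
-/

/-! ### Hadamard matrices: factorization, orthogonality, size of the entries -/

section HadamardMatrices

/-- The entry of the Hadamard matrix of order `2 ^ ℓ` as a function of natural numbers. -/
noncomputable def hadamardEntry : ℕ → ℕ → ℕ → ℝ
  | 0, _, _ => 1
  | ℓ + 1, a, b =>
    hadamardTwo (Fin.ofNat 2 (a / 2 ^ ℓ)) (Fin.ofNat 2 (b / 2 ^ ℓ)) *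
      hadamardEntry ℓ (a % 2 ^ ℓ) (b % 2 ^ ℓ)

theorem hadamard_apply (ℓ : ℕ) (i j : Fin (2 ^ ℓ)) : hadamard ℓ i j = hadamardEntry ℓ i j := by
  induction ℓ with
  | zero =>
    have : i = j := by ext; have := i.2; have := j.2; simp at *
    subst this
    simp [hadamard, hadamardEntry]
  | succ ℓ ih =>
    have h (i : Fin (2 ^ (ℓ + 1))) : (i : ℕ) / 2 ^ ℓ < 2 :=
      Nat.div_lt_of_lt_mul (by rw [← pow_succ]; exact i.2)
    simp only [hadamard, hadamardEntry, Matrix.reindex_apply, Matrix.submatrix_apply,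
      Matrix.kroneckerMap_apply, ih]
    congr 2 <;> ext <;> simp [Nat.mod_eq_of_lt (h _)]

/-- The last factor of the Kronecker power can be split off instead of the first one. -/
theorem hadamardEntry_succ (ℓ a b : ℕ) (ha : a < 2 ^ (ℓ + 1)) (hb : b < 2 ^ (ℓ + 1)) :
    hadamardEntry (ℓ + 1) a b =
      hadamardEntry ℓ (a / 2) (b / 2) * hadamardTwo (Fin.ofNat 2 a) (Fin.ofNat 2 b) := by
  induction ℓ generalizing a b with
  | zero => simp [hadamardEntry]
  | succ ℓ ih =>
    have hpos : 0 < 2 ^ (ℓ + 1) := by positivity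
    have key (a : ℕ) : a % 2 ^ (ℓ + 1) / 2 = a / 2 % 2 ^ ℓ := by
      rw [pow_succ', Nat.mod_mul_right_div_self]
    have key2 (a : ℕ) : Fin.ofNat 2 (a % 2 ^ (ℓ + 1)) = Fin.ofNat 2 a := by
      ext
      simp [pow_succ']
    have key3 (a : ℕ) : a / 2 ^ (ℓ + 1) = a / 2 / 2 ^ ℓ := by
      rw [pow_succ', Nat.div_div_eq_div_mul]
    rw [hadamardEntry, ih _ _ (Nat.mod_lt _ hpos) (Nat.mod_lt _ hpos), hadamardEntry, key, key,
      key2, key2, key3, key3, mul_assoc]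

theorem hadamardTwo_mul_transpose : hadamardTwo * hadamardTwo.transpose = 1 := by
  have h2 : (√2)⁻¹ * (√2)⁻¹ = (1 / 2 : ℝ) := by rw [← mul_inv]; norm_num
  ext i j
  fin_cases i <;> fin_cases j <;>
    simp [hadamardTwo, Matrix.mul_apply, Fin.sum_univ_two, h2] <;> norm_num

theorem hadamard_mul_transpose (ℓ : ℕ) : hadamard ℓ * (hadamard ℓ).transpose = 1 := by
  induction ℓ with
  | zero => simp [hadamard]
  | succ ℓ ih =>
    simp only [hadamard, Matrix.reindex_apply, Matrix.transpose_submatrix]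
    rw [Matrix.submatrix_mul_equiv, ← Matrix.kroneckerMap_transpose,
      ← Matrix.mul_kronecker_mul, ih, hadamardTwo_mul_transpose, Matrix.one_kronecker_one,
      Matrix.submatrix_one_equiv]

theorem hadamard_transpose_mul (ℓ : ℕ) : (hadamard ℓ).transpose * hadamard ℓ = 1 :=
  mul_eq_one_comm.mp (hadamard_mul_transpose ℓ)

theorem hadamardTwo_sq (i j : Fin 2) : hadamardTwo i j ^ 2 = 1 / 2 := by
  fin_cases i <;> fin_cases j <;> simp [hadamardTwo]

/-- Equal magnitudes give all rotated symbols the same weight in the conditional variance, so that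
Parseval applies to it. -/
theorem hadamard_sq (ℓ : ℕ) (i j : Fin (2 ^ ℓ)) : hadamard ℓ i j ^ 2 = 1 / 2 ^ ℓ := by
  rw [hadamard_apply]
  generalize (i : ℕ) = a
  generalize (j : ℕ) = b
  clear i j
  induction ℓ generalizing a b with
  | zero => simp [hadamardEntry]
  | succ ℓ ih => rw [hadamardEntry, mul_pow, hadamardTwo_sq, ih, pow_succ']; ring

end HadamardMatrices

/-! ### Hadamard rotations as complex scalar multiples of `H_N` -/

section Rotations

/-- The rotation `H ⊗ T` of the real components, where the real `2 × 2` matrix `T` is the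
multiplication by the complex number `c`, applies `H` to the complex signal multiplied by `c`. -/
theorem rotateSignal_kronecker {N : ℕ} (H : Matrix (Fin N) (Fin N) ℝ)
    (T : Matrix (Fin 2) (Fin 2) ℝ) (c : ℂ) (h00 : T 0 0 = c.re) (h01 : T 0 1 = -c.im)
    (h10 : T 1 0 = c.im) (h11 : T 1 1 = c.re) (z : Fin N → ℂ) (i : Fin N) :
    rotateSignal (Matrix.reindex finProdFinEquiv finProdFinEquiv (H ⊗ₖ T)) z i =
      c * ∑ k, (H i k : ℂ) * z k := by
  have key (p : Fin 2) : (Matrix.reindex finProdFinEquiv finProdFinEquiv (H ⊗ₖ T)).mulVec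
      (toRealComponents z) (finProdFinEquiv (i, p)) =
      ∑ k, H i k * (T p 0 * (z k).re + T p 1 * (z k).im) := by
    rw [Matrix.mulVec, dotProduct, ← finProdFinEquiv.sum_comp, Fintype.sum_prod_type]
    simp only [Fin.sum_univ_two, Matrix.reindex_apply, Matrix.submatrix_apply,
      Equiv.symm_apply_apply, Matrix.kroneckerMap_apply, toRealComponents]
    exact Finset.sum_congr rfl fun k _ => by simp; ring
  rw [rotateSignal, ofRealComponents, key, key, h00, h01, h10, h11, Finset.mul_sum]
  push_cast
  rw [Finset.sum_mul, ← Finset.sum_add_distrib]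
  refine Finset.sum_congr rfl fun k _ => ?_
  apply Complex.ext <;> simp <;> ring

theorem hadamardRealBasis_eq (ℓ : ℕ) : hadamardRealBasis ℓ =
    Matrix.reindex finProdFinEquiv finProdFinEquiv (hadamard ℓ ⊗ₖ hadamardTwo) := by
  ext i j
  have h (i : Fin (2 ^ ℓ * 2)) : (i : ℕ) < 2 ^ (ℓ + 1) := by rw [pow_succ]; exact i.2
  simp only [hadamardRealBasis, Matrix.reindex_apply, Matrix.submatrix_apply,
    Matrix.kroneckerMap_apply, hadamard_apply]
  rw [hadamardEntry_succ]
  · congr 2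
  · exact h i
  · exact h j

/-- A Hadamard rotation is the Hadamard matrix of the channels combined with a multiplication by
a complex number of modulus one. -/
theorem IsHadamardRotation.exists_rotateSignal_eq {ℓ : ℕ}
    {R : Matrix (Fin (2 ^ ℓ * 2)) (Fin (2 ^ ℓ * 2)) ℝ} (hR : IsHadamardRotation ℓ R) :
    ∃ c : ℂ, ‖c‖ = 1 ∧
      (∀ z i, rotateSignal R z i = c * ∑ k, (hadamard ℓ i k : ℂ) * z k) ∧
      ∀ z i, rotateSignal R.transpose z i = star c * ∑ k, (hadamard ℓ k i : ℂ) * z k := by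
  have aux (T : Matrix (Fin 2) (Fin 2) ℝ) (c : ℂ) (h00 : T 0 0 = c.re) (h01 : T 0 1 = -c.im)
      (h10 : T 1 0 = c.im) (h11 : T 1 1 = c.re)
      (h : R = Matrix.reindex finProdFinEquiv finProdFinEquiv (hadamard ℓ ⊗ₖ T)) :
      (∀ z i, rotateSignal R z i = c * ∑ k, (hadamard ℓ i k : ℂ) * z k) ∧
      ∀ z i, rotateSignal R.transpose z i = star c * ∑ k, (hadamard ℓ k i : ℂ) * z k := by
    refine ⟨fun z i => ?_, fun z i => ?_⟩
    · rw [h, rotateSignal_kronecker _ _ c h00 h01 h10 h11]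
    · rw [h, Matrix.transpose_reindex, ← Matrix.kroneckerMap_transpose,
        rotateSignal_kronecker _ _ (star c)] <;> simp [h00, h01, h10, h11]
  rcases hR with h | h
  -- On the pair (real part, imaginary part), `hadamardTwo` is multiplication by `e^{-jπ/4}`.
  · refine ⟨⟨1 / √2, -(1 / √2)⟩, ?_, aux hadamardTwo _ ?_ ?_ ?_ ?_
      (h.trans (hadamardRealBasis_eq ℓ))⟩
    · rw [Complex.norm_def, Complex.normSq_mk, Real.sqrt_eq_one, neg_mul_neg, div_mul_div_comm,
        Real.mul_self_sqrt (by norm_num)]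
      norm_num
    all_goals simp [hadamardTwo]
  · refine ⟨1, by simp, aux 1 1 (by simp) (by simp) (by simp) (by simp) h⟩

/-- The rotation contributes `c` and its transpose `star c`. On the signal path the two meet and
cancel, as scalars commute with the phases; the additive noise passes only the derotation and keeps
`star c`. -/
theorem IsHadamardRotation.exists_derotatedSignal_eq {ℓ : ℕ}
    {R : Matrix (Fin (2 ^ ℓ * 2)) (Fin (2 ^ ℓ * 2)) ℝ} (hR : IsHadamardRotation ℓ R) :
    ∃ c : ℂ, ‖c‖ = 1 ∧ ∀ s θ n i, derotatedSignal R s θ n i =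
      ∑ k, (hadamard ℓ k i : ℂ) * (Complex.exp (θ k * Complex.I) *
        ∑ m, (hadamard ℓ k m : ℂ) * s m) + ∑ k, (hadamard ℓ k i : ℂ) * (c * n k) := by
  obtain ⟨c, hc, h, hT⟩ := hR.exists_rotateSignal_eq
  have hcc : star c * c = 1 := by
    rw [Complex.star_def, mul_comm, Complex.mul_conj, Complex.normSq_eq_norm_sq, hc]
    simp
  refine ⟨star c, by simpa using hc, fun s θ n i => ?_⟩
  rw [derotatedSignal, hT, Finset.mul_sum, ← Finset.sum_add_distrib]
  refine Finset.sum_congr rfl fun k _ => ?_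
  rw [receivedSignal, Pi.add_apply, Matrix.mulVec_diagonal, h]
  linear_combination (hadamard ℓ k i : ℂ) * (Complex.exp (θ k * Complex.I) *
        ∑ m, (hadamard ℓ k m : ℂ) * s m) * hcc

end Rotations

/-! ### Gaussian approximation of characteristic functions, with third-order error -/

section CharacteristicFunctionBounds

open Complex

theorem norm_prod_sub_prod_le_sum {ι : Type*} (s : Finset ι) (f g : ι → ℂ)
    (hf : ∀ i, ‖f i‖ ≤ 1) (hg : ∀ i, ‖g i‖ ≤ 1) :
    ‖∏ i ∈ s, f i - ∏ i ∈ s, g i‖ ≤ ∑ i ∈ s, ‖f i - g i‖ := by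
  classical
  induction s using Finset.induction_on with
  | empty => simp
  | insert a s ha ih =>
    rw [Finset.prod_insert ha, Finset.prod_insert ha, Finset.sum_insert ha]
    have h1 : ‖∏ i ∈ s, g i‖ ≤ 1 := by
      rw [norm_prod]
      exact Finset.prod_le_one (fun _ _ => norm_nonneg _) fun i _ => hg i
    calc ‖f a * ∏ i ∈ s, f i - g a * ∏ i ∈ s, g i‖
        = ‖(f a - g a) * ∏ i ∈ s, g i + f a * (∏ i ∈ s, f i - ∏ i ∈ s, g i)‖ := by
          congr 1; ring
      _ ≤ ‖f a - g a‖ * 1 + 1 * ∑ i ∈ s, ‖f i - g i‖ := by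
          refine (norm_add_le _ _).trans ?_
          rw [norm_mul, norm_mul]
          gcongr
          exact hf a
      _ = _ := by ring

theorem norm_exp_mul_I_sub_le {x : ℝ} (hx : |x| ≤ 1) :
    ‖exp (x * I) - (1 + x * I - x ^ 2 / 2)‖ ≤ |x| ^ 3 / 2 := by
  have hn : ‖(x * I : ℂ)‖ = |x| := by simp
  have := Complex.exp_bound (x := x * I) (by rwa [hn]) (n := 3) (by norm_num)
  rw [hn] at this
  have e : ∑ m ∈ Finset.range 3, (x * I : ℂ) ^ m / (m.factorial : ℂ) =
      1 + x * I - x ^ 2 / 2 := by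
    simp only [Finset.sum_range_succ, Finset.sum_range_zero, Nat.factorial]
    push_cast
    rw [mul_pow (x : ℂ) I 2, I_sq]
    ring
  rw [e] at this
  refine this.trans ?_
  have := pow_nonneg (abs_nonneg x) 3
  norm_num [Nat.factorial]
  linarith

theorem abs_exp_neg_sub_exp_neg_le {x y : ℝ} (hx : 0 ≤ x) (hy : 0 ≤ y) :
    |Real.exp (-x) - Real.exp (-y)| ≤ |x - y| := by
  have aux {x y : ℝ} (hx : 0 ≤ x) : Real.exp (-x) - Real.exp (-y) ≤ |x - y| := by
    have h1 := Real.add_one_le_exp (x - y)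
    have h2 : Real.exp (-y) = Real.exp (-x) * Real.exp (x - y) := by
      rw [← Real.exp_add]; congr 1; ring
    have h3 : Real.exp (-x) ≤ 1 := Real.exp_le_one_iff.mpr (by linarith)
    have h4 := Real.exp_pos (-x)
    have h5 := neg_abs_le (x - y)
    have h6 := abs_nonneg (x - y)
    nlinarith
  rw [abs_le']
  refine ⟨aux hx, ?_⟩
  rw [neg_sub, abs_sub_comm]
  exact aux hy

/-- The characteristic function at `1` of a bounded centred random variable is close to that of the
Gaussian with the same variance. -/
theorem norm_integral_exp_sub_gaussian_le {Ω : Type*} [MeasurableSpace Ω] {P : Measure Ω}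
    [IsProbabilityMeasure P] {Y : Ω → ℝ} (hY : AEMeasurable Y P) {K : ℝ}
    (hYK : ∀ᵐ ω ∂P, |Y ω| ≤ K) (hmean : ∫ ω, Y ω ∂P = 0) :
    ‖∫ ω, exp (Y ω * I) ∂P - (Real.exp (-(∫ ω, Y ω ^ 2 ∂P) / 2) : ℂ)‖ ≤ 2 * K ^ 3 := by
  have hK : 0 ≤ K := by
    obtain ⟨ω, hω⟩ := hYK.exists
    exact (abs_nonneg _).trans hω
  set q := ∫ ω, Y ω ^ 2 ∂P with hq
  have hq0 : 0 ≤ q := integral_nonneg fun ω => sq_nonneg _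
  have hexp : Integrable (fun ω => exp (Y ω * I)) P :=
    Integrable.of_bound (by fun_prop) 1 (by simp [norm_exp_ofReal_mul_I])
  -- Taylor expansion is used for `K ≤ 1` only; for larger `K` the trivial bound `2` is below `2 * K
  -- ^ 3`.
  rcases le_or_gt K 1 with hK1 | hK1
  · have hYint : Integrable Y P := Integrable.of_bound hY.aestronglyMeasurable K (by simpa using hYK)
    have hY2b : ∀ᵐ ω ∂P, Y ω ^ 2 ≤ K ^ 2 := by
      filter_upwards [hYK] with ω h
      rw [← sq_abs]; gcongr
    have hY2 : Integrable (fun ω => Y ω ^ 2) P :=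
      Integrable.of_bound (by fun_prop) (K ^ 2) (by simpa using hY2b)
    have hqK : q ≤ K ^ 2 := by
      have := integral_mono_ae hY2 (integrable_const (K ^ 2)) hY2b
      simpa using this
    have e1 : ∫ ω, (1 + Y ω * I - (Y ω : ℂ) ^ 2 / 2) ∂P = 1 - (q : ℂ) / 2 := by
      have i1 : Integrable (fun ω => (Y ω : ℂ) * I) P := hYint.ofReal.mul_const I
      have i2 : Integrable (fun ω => (Y ω : ℂ) ^ 2 / 2) P := by
        have := (hY2.ofReal (𝕜 := ℂ)).div_const 2
        simpa using this
      have i0 : Integrable (fun ω => 1 + (Y ω : ℂ) * I) P := (integrable_const _).add i1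
      rw [integral_sub i0 i2, integral_add (integrable_const _) i1,
        integral_mul_const, integral_div, integral_complex_ofReal, hmean]
      have : ∫ ω, (Y ω : ℂ) ^ 2 ∂P = (q : ℂ) := by
        rw [hq, ← integral_complex_ofReal]; simp
      rw [this]
      simp
    have i3 : Integrable (fun ω => (1 + Y ω * I - (Y ω : ℂ) ^ 2 / 2)) P :=
      ((integrable_const _).add (hYint.ofReal.mul_const I)).sub (by
        have := (hY2.ofReal (𝕜 := ℂ)).div_const 2
        simpa using this)
    have h1 : ‖∫ ω, exp (Y ω * I) ∂P - (1 - (q : ℂ) / 2)‖ ≤ K ^ 3 / 2 := by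
      rw [← e1, ← integral_sub hexp i3]
      have := norm_integral_le_of_norm_le (μ := P) (integrable_const (K ^ 3 / 2))
        (f := fun ω => exp (Y ω * I) - (1 + Y ω * I - (Y ω : ℂ) ^ 2 / 2)) (by
          filter_upwards [hYK] with ω h
          refine (norm_exp_mul_I_sub_le (h.trans hK1)).trans ?_
          gcongr)
      simpa using this
    have hK2 : K ^ 2 ≤ 1 := pow_le_one₀ hK hK1
    have h2 : |Real.exp (-(q / 2)) - 1 - (-(q / 2))| ≤ (-(q / 2)) ^ 2 :=
      Real.abs_exp_sub_one_sub_id_le (by rw [abs_le]; constructor <;> linarith)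
    have h3 : ‖(1 - (q : ℂ) / 2) - (Real.exp (-q / 2) : ℂ)‖ ≤ K ^ 3 := by
      have : (1 - (q : ℂ) / 2) - (Real.exp (-q / 2) : ℂ) =
          ((-(Real.exp (-(q / 2)) - 1 - (-(q / 2))) : ℝ) : ℂ) := by
        rw [neg_div]
        push_cast
        ring
      rw [this, norm_real, Real.norm_eq_abs, abs_neg]
      refine h2.trans ?_
      have : q ^ 2 ≤ (K ^ 2) ^ 2 := by gcongr
      have : (K ^ 2) ^ 2 ≤ K ^ 3 := by
        have := mul_le_mul_of_nonneg_left hK1 (pow_nonneg hK 3)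
        nlinarith
      have := sq_nonneg q
      linarith
    calc _ ≤ K ^ 3 / 2 + K ^ 3 := by
          rw [← sub_add_sub_cancel _ (1 - (q : ℂ) / 2)]
          exact (norm_add_le _ _).trans (add_le_add h1 h3)
      _ ≤ _ := by have := pow_nonneg hK 3; linarith
  · have h1 : ‖∫ ω, exp (Y ω * I) ∂P‖ ≤ 1 := by
      have := norm_integral_le_of_norm_le (μ := P) (integrable_const (1 : ℝ))
        (f := fun ω => exp (Y ω * I)) (by simp [norm_exp_ofReal_mul_I])
      simpa using this
    have h2 : ‖(Real.exp (-q / 2) : ℂ)‖ ≤ 1 := by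
      rw [norm_real, Real.norm_eq_abs, abs_of_pos (Real.exp_pos _), Real.exp_le_one_iff]
      linarith
    have h3 : 1 ≤ K ^ 3 := one_le_pow₀ hK1.le
    refine (norm_sub_le _ _).trans ?_
    linarith

theorem norm_integral_le_one {κ : Measure ℂ} [IsProbabilityMeasure κ]
    (hκ : ∀ᵐ z ∂κ, ‖z‖ ≤ 1) : ‖∫ z, z ∂κ‖ ≤ 1 := by
  have := norm_integral_le_of_norm_le (μ := κ) (integrable_const (1 : ℝ)) hκ
  simpa using this

theorem integral_sub_integral_eq_zero {κ : Measure ℂ} [IsProbabilityMeasure κ]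
    (hκ : ∀ᵐ z ∂κ, ‖z‖ ≤ 1) : ∫ z, (z - ∫ w, w ∂κ) ∂κ = 0 := by
  have h : Integrable (fun z : ℂ => z) κ := Integrable.of_bound (by fun_prop) 1 hκ
  rw [integral_sub h (integrable_const _)]
  simp

/-- After centring, the real variable along `t` is bounded by `2 * ‖t‖`, whence `2 * (2 * ‖t‖) ^ 3 =
16 * ‖t‖ ^ 3`; the mean contributes only a unimodular factor. -/
theorem norm_charFun_sub_gaussian_le {κ : Measure ℂ} [IsProbabilityMeasure κ]
    (hκ : ∀ᵐ z ∂κ, ‖z‖ ≤ 1) (t : ℂ) :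
    ‖charFun κ t - exp (inner ℝ (∫ z, z ∂κ) t * I) *
      (Real.exp (-(∫ z, inner ℝ (z - ∫ w, w ∂κ) t ^ 2 ∂κ) / 2) : ℂ)‖ ≤ 16 * ‖t‖ ^ 3 := by
  set m := ∫ z, z ∂κ
  have hint : Integrable (fun z : ℂ => z) κ := Integrable.of_bound (by fun_prop) 1 hκ
  have hm : ‖m‖ ≤ 1 := norm_integral_le_one hκ
  have h := norm_integral_exp_sub_gaussian_le (P := κ) (Y := fun z => inner ℝ (z - m) t)
    (by fun_prop) (K := 2 * ‖t‖) (by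
      filter_upwards [hκ] with z hz
      refine (abs_real_inner_le_norm _ _).trans ?_
      gcongr
      exact (norm_sub_le _ _).trans (by linarith)) (by
      have := integral_inner (𝕜 := ℝ) (hint.sub (integrable_const m)) t
      simp only [Pi.sub_apply] at this
      rw [integral_sub_integral_eq_zero hκ, inner_zero_right] at this
      rw [← this]
      exact integral_congr_ae (ae_of_all _ fun z => real_inner_comm _ _))
  have e : charFun κ t = exp (inner ℝ m t * I) * ∫ z, exp (inner ℝ (z - m) t * I) ∂κ := by
    rw [charFun_apply, ← integral_const_mul]
    congr 1
    ext z
    rw [← exp_add, inner_sub_left]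
    push_cast
    ring_nf
  rw [e, ← mul_sub, norm_mul, norm_exp_ofReal_mul_I, one_mul]
  refine h.trans (le_of_eq ?_)
  ring

/-- Independent factors: a product of characteristic functions of bounded random variables is close
to the characteristic function of a Gaussian. -/
theorem norm_prod_charFun_sub_gaussian_le {κ : Measure ℂ} [IsProbabilityMeasure κ]
    (hκ : ∀ᵐ z ∂κ, ‖z‖ ≤ 1) {ι : Type*} [Fintype ι] (t : ι → ℂ) :
    ‖∏ k, charFun κ (t k) - exp ((∑ k, inner ℝ (∫ z, z ∂κ) (t k) : ℝ) * I) *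
      (Real.exp (-(∑ k, ∫ z, inner ℝ (z - ∫ w, w ∂κ) (t k) ^ 2 ∂κ) / 2) : ℂ)‖ ≤
      16 * ∑ k, ‖t k‖ ^ 3 := by
  have e : exp ((∑ k, inner ℝ (∫ z, z ∂κ) (t k) : ℝ) * I) *
      (Real.exp (-(∑ k, ∫ z, inner ℝ (z - ∫ w, w ∂κ) (t k) ^ 2 ∂κ) / 2) : ℂ) =
      ∏ k, (exp (inner ℝ (∫ z, z ∂κ) (t k) * I) *
      (Real.exp (-(∫ z, inner ℝ (z - ∫ w, w ∂κ) (t k) ^ 2 ∂κ) / 2) : ℂ)) := by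
    rw [Finset.prod_mul_distrib, ← exp_sum, ← ofReal_prod, ← Real.exp_sum, ← Finset.sum_div,
      Finset.sum_neg_distrib, ofReal_sum, Finset.sum_mul]
  rw [e]
  refine (norm_prod_sub_prod_le_sum _ _ _ (fun k => norm_charFun_le_one _) fun k => ?_).trans ?_
  · rw [norm_mul, norm_exp_ofReal_mul_I, one_mul, norm_real, Real.norm_eq_abs,
      abs_of_pos (Real.exp_pos _), Real.exp_le_one_iff]
    have : 0 ≤ ∫ z, inner ℝ (z - ∫ w, w ∂κ) (t k) ^ 2 ∂κ := integral_nonneg fun _ => sq_nonneg _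
    linarith
  · rw [Finset.mul_sum]
    exact Finset.sum_le_sum fun k _ => norm_charFun_sub_gaussian_le hκ (t k)

end CharacteristicFunctionBounds

/-! ### Moment bounds and weak law for independent bounded variables -/

section IndependentSums

variable {μ : Measure ℂ} [IsProbabilityMeasure μ] {K : ℝ}

theorem ae_pi_forall {ι : Type*} [Fintype ι] {p : ℂ → Prop} (h : ∀ᵐ x ∂μ, p x) :
    ∀ᵐ s ∂(Measure.pi fun _ : ι => μ), ∀ k, p (s k) :=
  ae_all_iff.mpr fun k =>
    (measurePreserving_eval (fun _ : ι => μ) k).quasiMeasurePreserving.ae h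

/-- The third absolute moment of a normalized sum of independent centred bounded variables is
bounded independently of the number of summands. -/
theorem integral_abs_sum_pow_three_le {ι : Type*} [Fintype ι] {f : ℂ → ℝ} (hf : Measurable f)
    (hfK : ∀ᵐ x ∂μ, |f x| ≤ K) (hmean : ∫ x, f x ∂μ = 0) (h : ι → ℝ) (hh : ∑ m, h m ^ 2 = 1) :
    Integrable (fun s : ι → ℂ => |∑ m, h m * f (s m)| ^ 3) (Measure.pi fun _ => μ) ∧
    ∫ s, |∑ m, h m * f (s m)| ^ 3 ∂(Measure.pi fun _ : ι => μ) ≤ 12 * Real.exp (K ^ 2 / 2) := by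
  have hK : 0 ≤ K := by
    obtain ⟨ω, hω⟩ := hfK.exists
    exact (abs_nonneg _).trans hω
  -- Hoeffding's sub-Gaussian parameter for a centred variable in `[-K, K]`. Weights with squares
  -- summing to one leave it unchanged for the sum, hence no dependence on the number of terms.
  set c : ℝ≥0 := (‖K - -K‖₊ / 2) ^ 2 with hc
  have hcK : (c : ℝ) = K ^ 2 := by
    rw [hc]
    push_cast
    rw [Real.norm_eq_abs, abs_of_nonneg (by linarith)]
    ring
  have hsub (m : ι) : HasSubgaussianMGF (fun s : ι → ℂ => f (s m)) c (Measure.pi fun _ => μ) := by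
    refine hasSubgaussianMGF_of_mem_Icc_of_integral_eq_zero
      (hf.comp (measurable_pi_apply m)).aemeasurable ?_ ?_
    · filter_upwards [ae_pi_forall (ι := ι) hfK] with s hs
      exact abs_le.mp (hs m)
    · rw [integral_comp_eval (μ := fun _ : ι => μ) (i := m) (f := f) hf.aestronglyMeasurable, hmean]
  have hind : iIndepFun (fun m (s : ι → ℂ) => h m * f (s m)) (Measure.pi fun _ => μ) :=
    iIndepFun_pi (X := fun m x => h m * f x) fun m => by fun_prop
  have hsum := HasSubgaussianMGF.sum_of_iIndepFun hind (s := Finset.univ)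
    fun m _ => (hsub m).const_mul (h m)
  set S : (ι → ℂ) → ℝ := fun s => ∑ m, h m * f (s m) with hS
  have hSm : Measurable S := by fun_prop
  have hpar : ((∑ m, (NNReal.mk (h m ^ 2) (sq_nonneg _)) * c : ℝ≥0) : ℝ) = K ^ 2 := by
    push_cast
    rw [← Finset.sum_mul, hcK]
    change (∑ m, h m ^ 2) * _ = _
    rw [hh, one_mul]
  obtain ⟨d, hd, hsum⟩ : ∃ d : ℝ≥0, (d : ℝ) = K ^ 2 ∧
      HasSubgaussianMGF S d (Measure.pi fun _ => μ) := ⟨_, hpar, hsum⟩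
  have h1 := hsum.mgf_le 1
  have h2 := hsum.mgf_le (-1)
  rw [hd] at h1 h2
  have i1 := hsum.integrable_exp_mul 1
  have i2 := hsum.integrable_exp_mul (-1)
  -- From `|S| ^ 3 / 3! ≤ e^{|S|}`; the moment generating function at `1` and `-1` then gives `6 * 2
  -- * e^{K² / 2}`.
  have hpt (s : ι → ℂ) : |S s| ^ 3 ≤ 6 * (Real.exp (1 * S s) + Real.exp (-1 * S s)) := by
    have h3 := Real.pow_div_factorial_le_exp (|S s|) (abs_nonneg _) 3
    have h4 : Real.exp |S s| ≤ Real.exp (1 * S s) + Real.exp (-1 * S s) := by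
      rw [one_mul, neg_one_mul]
      rcases abs_choice (S s) with e | e <;> rw [e]
      · linarith [Real.exp_pos (-S s)]
      · linarith [Real.exp_pos (S s)]
    norm_num [Nat.factorial] at h3
    linarith
  have hint : Integrable (fun s => 6 * (Real.exp (1 * S s) + Real.exp (-1 * S s)))
      (Measure.pi fun _ => μ) := (i1.add i2).const_mul 6
  have hi : Integrable (fun s => |S s| ^ 3) (Measure.pi fun _ => μ) :=
    hint.mono' (by fun_prop) (ae_of_all _ fun s => by
      rw [Real.norm_eq_abs, abs_of_nonneg (by positivity)]
      exact hpt s)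
  refine ⟨hi, (integral_mono hi hint hpt).trans ?_⟩
  rw [integral_const_mul, integral_add i1 i2]
  rw [mgf] at h1 h2
  norm_num at h1 h2 ⊢
  linarith

/-- The real weights act separately on real and imaginary parts; with `(x + y) ^ 3 ≤ 4 * (x ^ 3 + y
^ 3)` the constant is `4 * (12 + 12) = 96`. -/
theorem integral_norm_sum_pow_three_le {ι : Type*} [Fintype ι]
    (hK : ∀ᵐ x ∂μ, ‖x‖ ≤ K) (hmean : ∫ x, x ∂μ = 0) (h : ι → ℝ) (hh : ∑ m, h m ^ 2 = 1) :
    Integrable (fun s : ι → ℂ => ‖∑ m, (h m : ℂ) * s m‖ ^ 3) (Measure.pi fun _ => μ) ∧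
    ∫ s, ‖∑ m, (h m : ℂ) * s m‖ ^ 3 ∂(Measure.pi fun _ : ι => μ) ≤ 96 * Real.exp (K ^ 2 / 2) := by
  have hint : Integrable (fun x : ℂ => x) μ := Integrable.of_bound (by fun_prop) K hK
  obtain ⟨i1, b1⟩ := integral_abs_sum_pow_three_le (μ := μ) (K := K) (f := Complex.re)
    Complex.measurable_re (by filter_upwards [hK] with x hx using (Complex.abs_re_le_norm x).trans hx)
    (by
      have := integral_re (𝕜 := ℂ) hint
      simpa [hmean] using this) h hh
  obtain ⟨i2, b2⟩ := integral_abs_sum_pow_three_le (μ := μ) (K := K) (f := Complex.im)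
    Complex.measurable_im (by filter_upwards [hK] with x hx using (Complex.abs_im_le_norm x).trans hx)
    (by
      have := integral_im (𝕜 := ℂ) hint
      simpa [hmean] using this) h hh
  have hpt (s : ι → ℂ) : ‖∑ m, (h m : ℂ) * s m‖ ^ 3 ≤
      4 * (|∑ m, h m * (s m).re| ^ 3 + |∑ m, h m * (s m).im| ^ 3) := by
    have e1 : (∑ m, (h m : ℂ) * s m).re = ∑ m, h m * (s m).re := by simp
    have e2 : (∑ m, (h m : ℂ) * s m).im = ∑ m, h m * (s m).im := by simp
    rw [← e1, ← e2]
    refine (pow_le_pow_left₀ (norm_nonneg _) (Complex.norm_le_abs_re_add_abs_im _) 3).trans ?_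
    have := add_pow_le (abs_nonneg (∑ m, (h m : ℂ) * s m).re)
      (abs_nonneg (∑ m, (h m : ℂ) * s m).im) 3
    norm_num at this ⊢
    exact this
  have hint : Integrable (fun s : ι → ℂ =>
      4 * (|∑ m, h m * (s m).re| ^ 3 + |∑ m, h m * (s m).im| ^ 3)) (Measure.pi fun _ => μ) :=
    (i1.add i2).const_mul 4
  have hi : Integrable (fun s : ι → ℂ => ‖∑ m, (h m : ℂ) * s m‖ ^ 3) (Measure.pi fun _ => μ) :=
    hint.mono' (Continuous.aestronglyMeasurable (by fun_prop)) (ae_of_all _ fun s => by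
      rw [Real.norm_eq_abs, abs_of_nonneg (by positivity)]
      exact hpt s)
  refine ⟨hi, (integral_mono hi hint hpt).trans ?_⟩
  rw [integral_const_mul, integral_add i1 i2]
  linarith

/-- A quantitative weak law of large numbers. -/
theorem integral_abs_average_sub_le {N : ℕ} (hN : 0 < N) {q : ℂ → ℝ} (hq : Measurable q)
    (hqK : ∀ᵐ x ∂μ, |q x| ≤ K) :
    Integrable (fun s : Fin N → ℂ => |(∑ m, q (s m)) / N - ∫ x, q x ∂μ|) (Measure.pi fun _ => μ) ∧
    ∫ s, |(∑ m, q (s m)) / N - ∫ x, q x ∂μ| ∂(Measure.pi fun _ : Fin N => μ) ≤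
      (1 + K ^ 2) / √N := by
  set Q := Measure.pi fun _ : Fin N => μ
  have hN' : (0 : ℝ) < N := by exact_mod_cast hN
  have hsN : 0 < √(N : ℝ) := Real.sqrt_pos.mpr hN'
  have hqm (m : Fin N) : Measurable fun s : Fin N → ℂ => q (s m) :=
    hq.comp (measurable_pi_apply m)
  have hLp (m : Fin N) : MemLp (fun s : Fin N → ℂ => q (s m)) 2 Q := by
    refine MemLp.of_bound (hqm m).aestronglyMeasurable K ?_
    filter_upwards [ae_pi_forall (ι := Fin N) hqK] with s hs using hs m
  have hE (m : Fin N) : ∫ s, q (s m) ∂Q = ∫ x, q x ∂μ :=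
    integral_comp_eval (μ := fun _ : Fin N => μ) (i := m) (f := q) hq.aestronglyMeasurable
  have hind : iIndepFun (fun m (s : Fin N → ℂ) => q (s m)) Q :=
    iIndepFun_pi (X := fun m x => q x) fun m => by fun_prop
  have hvar := IndepFun.variance_sum (s := Finset.univ) (fun m _ => hLp m)
    (fun a _ b _ hab => hind.indepFun hab)
  have hvm (m : Fin N) : Var[fun s : Fin N → ℂ => q (s m); Q] ≤ K ^ 2 := by
    refine (variance_le_expectation_sq (hqm m).aestronglyMeasurable).trans ?_
    have := integral_mono_ae (μ := Q) (hLp m).integrable_sq (integrable_const (K ^ 2)) (by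
      filter_upwards [ae_pi_forall (ι := Fin N) hqK] with s hs
      rw [← sq_abs]
      gcongr
      exact hs m)
    simpa using this
  set T : (Fin N → ℂ) → ℝ := ∑ m, fun s : Fin N → ℂ => q (s m) with hT
  have hTm : MemLp T 2 Q := memLp_finsetSum' _ fun m _ => hLp m
  have hTE : ∫ s, T s ∂Q = N * ∫ x, q x ∂μ := by
    simp only [hT, Finset.sum_apply]
    rw [integral_finsetSum _ fun m _ => (hLp m).integrable (by norm_num)]
    simp [hE]
  have hTV : ∫ s, (T s - N * ∫ x, q x ∂μ) ^ 2 ∂Q ≤ N * K ^ 2 := by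
    rw [← hTE, ← variance_eq_integral hTm.aestronglyMeasurable.aemeasurable, hvar]
    calc _ ≤ ∑ m : Fin N, K ^ 2 := Finset.sum_le_sum fun m _ => hvm m
      _ = _ := by simp
  set D : (Fin N → ℂ) → ℝ := fun s => T s - N * ∫ x, q x ∂μ
  have hD : MemLp D 2 Q := hTm.sub (memLp_const _)
  have hrew (s : Fin N → ℂ) : (∑ m, q (s m)) / N - ∫ x, q x ∂μ = D s / N := by
    simp only [D, hT, Finset.sum_apply]
    field_simp
  have hD1 : Integrable D Q := hD.integrable (by norm_num)
  simp only [hrew]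
  -- The arithmetic-geometric inequality `√N * |D| ≤ N + D ^ 2` reduces the first absolute moment to
  -- the variance without Cauchy-Schwarz.
  have hpt (s : Fin N → ℂ) : |D s / N| ≤ (√N)⁻¹ * (1 + D s ^ 2 / N) := by
    have hs : √(N : ℝ) ^ 2 = N := Real.sq_sqrt hN'.le
    have h1 : |D s| ≤ √N * (1 + D s ^ 2 / N) := by
      have : √N * (1 + D s ^ 2 / N) = (√N ^ 2 + |D s| ^ 2) / √N := by
        rw [sq_abs, eq_div_iff hsN.ne']
        field_simp
        rw [hs]
      rw [this, le_div_iff₀ hsN]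
      nlinarith [sq_nonneg (√N - |D s|), sq_nonneg (√N), sq_nonneg (|D s|)]
    rw [abs_div, Nat.abs_cast, div_le_iff₀ hN']
    calc |D s| ≤ √N * (1 + D s ^ 2 / N) := h1
      _ = (√N)⁻¹ * (1 + D s ^ 2 / N) * √N ^ 2 := by field_simp
      _ = _ := by rw [hs]
  have hi2 : Integrable (fun s => (√(N : ℝ))⁻¹ * (1 + D s ^ 2 / N)) Q :=
    ((integrable_const _).add (hD.integrable_sq.div_const _)).const_mul _
  have hi1 : Integrable (fun s => |D s / N|) Q := (hD1.div_const _).abs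
  refine ⟨hi1, (integral_mono hi1 hi2 hpt).trans ?_⟩
  rw [integral_const_mul, integral_add (integrable_const _) (hD.integrable_sq.div_const _),
    integral_div, inv_mul_eq_div]
  simp only [integral_const, probReal_univ, smul_eq_mul, mul_one]
  gcongr
  rw [div_le_iff₀ hN']
  linarith

end IndependentSums

/-! ### Conditional and joint characteristic functions of the phase noise contribution -/

section RotatedSums

open Complex ComplexConjugate

/-- The variance of the component along `b` of `z * x`, where `z` has law `κ`. -/
noncomputable def phaseVariance (κ : Measure ℂ) (b x : ℂ) : ℝ :=
  ∫ z, inner ℝ ((z - ∫ w, w ∂κ) * x) b ^ 2 ∂κ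

/-- Multiplication by `conj w` is the adjoint of multiplication by `w`, so a characteristic function
at `conj w * b` is that of the law scaled by `w`, taken at `b`. -/
theorem inner_conj_mul (z w b : ℂ) : inner ℝ z (conj w * b) = inner ℝ (z * w) b := by
  simp only [Complex.inner, map_mul]
  ring_nf

theorem inner_sum_ofReal_mul {ι : Type*} [Fintype ι] (c : ι → ℝ) (s : ι → ℂ) (y b : ℂ) :
    inner ℝ (y * ∑ m, (c m : ℂ) * s m) b = ∑ m, c m * inner ℝ (y * s m) b := by
  rw [Finset.mul_sum, sum_inner]
  refine Finset.sum_congr rfl fun m _ => ?_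
  rw [mul_left_comm, ← real_smul, real_inner_smul_left]

theorem phaseVariance_nonneg (κ : Measure ℂ) (b x : ℂ) : 0 ≤ phaseVariance κ b x :=
  integral_nonneg fun _ => sq_nonneg _

theorem phaseVariance_ofReal_mul (κ : Measure ℂ) (b : ℂ) (c : ℝ) (x : ℂ) :
    phaseVariance κ b (c * x) = c ^ 2 * phaseVariance κ b x := by
  rw [phaseVariance, phaseVariance, ← integral_const_mul]
  congr 1
  ext z
  rw [mul_left_comm, ← real_smul, real_inner_smul_left, mul_pow]

variable {κ : Measure ℂ} [IsProbabilityMeasure κ]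

theorem measurable_phaseVariance (b : ℂ) : Measurable (phaseVariance κ b) := by
  have h : Measurable fun p : ℂ × ℂ => inner ℝ ((p.2 - ∫ w, w ∂κ) * p.1) b ^ 2 := by fun_prop
  exact (h.stronglyMeasurable.integral_prod_right (ν := κ)).measurable

theorem ae_inner_sq_le (hκ : ∀ᵐ z ∂κ, ‖z‖ ≤ 1) (b x : ℂ) :
    ∀ᵐ z ∂κ, inner ℝ ((z - ∫ w, w ∂κ) * x) b ^ 2 ≤ (2 * ‖x‖ * ‖b‖) ^ 2 := by
  filter_upwards [hκ] with z hz
  rw [← sq_abs]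
  gcongr
  refine (abs_real_inner_le_norm _ _).trans ?_
  rw [norm_mul]
  gcongr
  exact (norm_sub_le _ _).trans (by linarith [norm_integral_le_one hκ])

theorem integrable_inner_sq (hκ : ∀ᵐ z ∂κ, ‖z‖ ≤ 1) (b x : ℂ) :
    Integrable (fun z => inner ℝ ((z - ∫ w, w ∂κ) * x) b ^ 2) κ :=
  Integrable.of_bound (by fun_prop) ((2 * ‖x‖ * ‖b‖) ^ 2) (by
    simpa using ae_inner_sq_le hκ b x)

theorem phaseVariance_le (hκ : ∀ᵐ z ∂κ, ‖z‖ ≤ 1) (b x : ℂ) :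
    phaseVariance κ b x ≤ (2 * ‖x‖ * ‖b‖) ^ 2 := by
  have := integral_mono_ae (integrable_inner_sq hκ b x) (integrable_const _)
    (ae_inner_sq_le hκ b x)
  rwa [integral_const, probReal_univ, one_smul] at this

theorem sum_sq_mulVec_eq {ι : Type*} [Fintype ι] [DecidableEq ι] {H : Matrix ι ι ℝ}
    (hH : H.transpose * H = 1) (v : ι → ℝ) : ∑ k, (∑ m, H k m * v m) ^ 2 = ∑ m, v m ^ 2 := by
  have h : dotProduct (H.mulVec v) (H.mulVec v) = dotProduct v v := by
    rw [Matrix.dotProduct_mulVec, Matrix.vecMul_mulVec, hH, Matrix.vecMul_one]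
  simpa only [dotProduct, Matrix.mulVec, ← sq] using h

theorem sum_sq_row_eq_one {ι : Type*} [Fintype ι] [DecidableEq ι] {H : Matrix ι ι ℝ}
    (hH : H.transpose * H = 1) (k : ι) : ∑ m, H k m ^ 2 = 1 := by
  have hH' : H * H.transpose = 1 := mul_eq_one_comm.mp hH
  have := congrFun (congrFun hH' k) k
  simpa [Matrix.mul_apply, ← sq] using this

/-- For each fixed `z` the component of `(z - m) * x` along `b` is real-linear in `x`, and `H` is
real. Parseval therefore holds under the integral, pointwise in `z`. -/
theorem sum_phaseVariance_eq (hκ : ∀ᵐ z ∂κ, ‖z‖ ≤ 1) {ι : Type*} [Fintype ι] [DecidableEq ι]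
    {H : Matrix ι ι ℝ} (hH : H.transpose * H = 1) (b : ℂ) (s : ι → ℂ) :
    ∑ k, phaseVariance κ b (∑ m, (H k m : ℂ) * s m) = ∑ m, phaseVariance κ b (s m) := by
  simp only [phaseVariance]
  rw [← integral_finsetSum _ fun k _ => integrable_inner_sq hκ b _,
    ← integral_finsetSum _ fun k _ => integrable_inner_sq hκ b _]
  congr 1
  ext z
  simp only [inner_sum_ofReal_mul]
  exact sum_sq_mulVec_eq hH _

theorem sum_transpose_mul_eq {ι : Type*} [Fintype ι] [DecidableEq ι] {H : Matrix ι ι ℝ}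
    (hH : H.transpose * H = 1) (s : ι → ℂ) (i : ι) :
    ∑ k, (H k i : ℂ) * ∑ m, (H k m : ℂ) * s m = s i := by
  simp only [Finset.mul_sum]
  rw [Finset.sum_comm]
  have h (m : ι) : ∑ k, (H k i : ℂ) * ((H k m : ℂ) * s m) = if i = m then s m else 0 := by
    have := congrFun (congrFun hH i) m
    rw [Matrix.mul_apply, Matrix.one_apply] at this
    simp only [Matrix.transpose_apply] at this
    simp only [← mul_assoc]
    rw [← Finset.sum_mul]
    have h2 : ∑ k, (H k i : ℂ) * (H k m : ℂ) = ((∑ k, H k i * H k m : ℝ) : ℂ) := by push_cast; rfl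
    rw [h2, this]
    split_ifs <;> simp
  simp [h]

/-- The conditional characteristic function, given the data `s`, of the phase noise contribution. -/
theorem norm_prod_charFun_rotated_sub_le (hκ : ∀ᵐ z ∂κ, ‖z‖ ≤ 1) {N : ℕ} (hN : 0 < N)
    {H : Matrix (Fin N) (Fin N) ℝ} (hH : H.transpose * H = 1) (i : Fin N)
    (hi : ∀ k, H k i ^ 2 = 1 / N) (b : ℂ) (s : Fin N → ℂ) {A : ℝ} (hA : 0 ≤ A) :
    ‖∏ k, charFun κ (conj ((H k i : ℂ) * ∑ m, (H k m : ℂ) * s m) * b) -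
      exp (inner ℝ ((∫ z, z ∂κ) * s i) b * I) * (Real.exp (-A / 2) : ℂ)‖ ≤
    16 * ‖b‖ ^ 3 * (∑ k, ‖∑ m, (H k m : ℂ) * s m‖ ^ 3) / (N * √N) +
      |(∑ m, phaseVariance κ b (s m)) / N - A| := by
  have hN' : (0 : ℝ) < N := by exact_mod_cast hN
  have h := norm_prod_charFun_sub_gaussian_le hκ
    fun k => conj ((H k i : ℂ) * ∑ m, (H k m : ℂ) * s m) * b
  have e1 : ∑ k, inner ℝ (∫ z, z ∂κ) (conj ((H k i : ℂ) * ∑ m, (H k m : ℂ) * s m) * b) =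
      inner ℝ ((∫ z, z ∂κ) * s i) b := by
    simp only [inner_conj_mul]
    rw [← sum_inner, ← Finset.mul_sum, sum_transpose_mul_eq hH]
  have e2 : ∑ k, ∫ z, inner ℝ (z - ∫ w, w ∂κ)
      (conj ((H k i : ℂ) * ∑ m, (H k m : ℂ) * s m) * b) ^ 2 ∂κ =
      (∑ m, phaseVariance κ b (s m)) / N := by
    simp only [inner_conj_mul]
    change ∑ k, phaseVariance κ b _ = _
    simp only [phaseVariance_ofReal_mul, hi]
    rw [← Finset.mul_sum, sum_phaseVariance_eq hκ hH]
    ring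
  have e3 (k : Fin N) : ‖conj ((H k i : ℂ) * ∑ m, (H k m : ℂ) * s m) * b‖ ^ 3 =
      ‖b‖ ^ 3 * ‖∑ m, (H k m : ℂ) * s m‖ ^ 3 / (N * √N) := by
    have : |H k i| = 1 / √N := by rw [← Real.sqrt_sq_eq_abs, hi]; simp
    rw [norm_mul, RCLike.norm_conj, norm_mul, norm_real, Real.norm_eq_abs, this]
    rw [mul_pow, mul_pow, div_pow, pow_succ √(N : ℝ) 2, Real.sq_sqrt hN'.le]
    ring
  rw [e1, e2] at h
  simp only [e3] at h
  set AN := (∑ m, phaseVariance κ b (s m)) / N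
  have hAN : 0 ≤ AN :=
    div_nonneg (Finset.sum_nonneg fun m _ => phaseVariance_nonneg κ b (s m)) hN'.le
  have h2 : ‖exp (inner ℝ ((∫ z, z ∂κ) * s i) b * I) * (Real.exp (-AN / 2) : ℂ) -
      exp (inner ℝ ((∫ z, z ∂κ) * s i) b * I) * (Real.exp (-A / 2) : ℂ)‖ ≤ |AN - A| := by
    rw [← mul_sub, norm_mul, norm_exp_ofReal_mul_I, one_mul, ← ofReal_sub, norm_real,
      Real.norm_eq_abs, neg_div, neg_div]
    refine (abs_exp_neg_sub_exp_neg_le (by positivity) (by positivity)).trans ?_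
    rw [← sub_div, abs_div, abs_two]
    linarith [abs_nonneg (AN - A)]
  -- The intermediate term is the Gaussian with the data-dependent variance `AN`; only afterwards is
  -- `AN` compared with `A`.
  rw [← sub_add_sub_cancel _ (exp (inner ℝ ((∫ z, z ∂κ) * s i) b * I) *
    (Real.exp (-AN / 2) : ℂ))]
  refine (norm_add_le _ _).trans (add_le_add (h.trans (le_of_eq ?_)) h2)
  rw [Finset.mul_sum, Finset.mul_sum, Finset.sum_div]
  exact Finset.sum_congr rfl fun k _ => by ring

variable {μ : Measure ℂ} [IsProbabilityMeasure μ] {K : ℝ}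

/-- The joint characteristic function of a symbol and of the derotated signal in the absence of
additive noise, up to an error of order `1 / √N`. -/
theorem norm_integral_charFun_sub_le (hκ : ∀ᵐ z ∂κ, ‖z‖ ≤ 1)
    (hK : ∀ᵐ x ∂μ, ‖x‖ ≤ K) (hmean : ∫ x, x ∂μ = 0) {N : ℕ} (hN : 0 < N)
    {H : Matrix (Fin N) (Fin N) ℝ} (hH : H.transpose * H = 1) (i : Fin N)
    (hi : ∀ k, H k i ^ 2 = 1 / N) (a b : ℂ) :
    ‖∫ s, exp (inner ℝ (s i) a * I) *
        ∏ k, charFun κ (conj ((H k i : ℂ) * ∑ m, (H k m : ℂ) * s m) * b)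
          ∂(Measure.pi fun _ : Fin N => μ) -
      (∫ x, exp (inner ℝ x a * I) * exp (inner ℝ ((∫ z, z ∂κ) * x) b * I) ∂μ) *
        (Real.exp (-(∫ x, phaseVariance κ b x ∂μ) / 2) : ℂ)‖ ≤
    (16 * ‖b‖ ^ 3 * (96 * Real.exp (K ^ 2 / 2)) + (1 + ((2 * K * ‖b‖) ^ 2) ^ 2)) / √N := by
  have hN' : (0 : ℝ) < N := by exact_mod_cast hN
  have hsN : 0 < √(N : ℝ) := Real.sqrt_pos.mpr hN'
  set Q := Measure.pi fun _ : Fin N => μ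
  set A := ∫ x, phaseVariance κ b x ∂μ with hAdef
  have hA : 0 ≤ A := integral_nonneg fun x => phaseVariance_nonneg κ b x
  set G : ℂ → ℂ := fun x => exp (inner ℝ x a * I) * exp (inner ℝ ((∫ z, z ∂κ) * x) b * I)
  have hG : Measurable G := by fun_prop
  have hGn (x : ℂ) : ‖G x‖ = 1 := by
    rw [norm_mul, norm_exp_ofReal_mul_I, norm_exp_ofReal_mul_I, one_mul]
  have e : (∫ x, G x ∂μ) * (Real.exp (-A / 2) : ℂ) =
      ∫ s, G (s i) * (Real.exp (-A / 2) : ℂ) ∂Q := by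
    rw [integral_mul_const]
    congr 1
    exact (integral_comp_eval (μ := fun _ : Fin N => μ) (i := i) hG.aestronglyMeasurable).symm
  have hm : Measurable fun s : Fin N → ℂ => exp (inner ℝ (s i) a * I) *
        ∏ k, charFun κ (conj ((H k i : ℂ) * ∑ m, (H k m : ℂ) * s m) * b) := by
    refine Measurable.mul (Continuous.measurable (by fun_prop)) ?_
    exact Finset.measurable_prod _ fun k _ =>
      measurable_charFun.comp (Continuous.measurable (by fun_prop))
  have i1 : Integrable (fun s : Fin N → ℂ => exp (inner ℝ (s i) a * I) *
        ∏ k, charFun κ (conj ((H k i : ℂ) * ∑ m, (H k m : ℂ) * s m) * b)) Q := by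
    refine Integrable.of_bound hm.aestronglyMeasurable 1 (ae_of_all _ fun s => ?_)
    rw [norm_mul, norm_exp_ofReal_mul_I, one_mul, norm_prod]
    exact Finset.prod_le_one (fun _ _ => norm_nonneg _) fun k _ => norm_charFun_le_one _
  have i2 : Integrable (fun s : Fin N → ℂ => G (s i) * (Real.exp (-A / 2) : ℂ)) Q := by
    refine Integrable.mul_const ?_ _
    exact Integrable.of_bound (hG.comp (measurable_pi_apply i)).aestronglyMeasurable 1
      (ae_of_all _ fun s => (hGn (s i)).le)
  have hb : ∀ᵐ x ∂μ, |phaseVariance κ b x| ≤ (2 * K * ‖b‖) ^ 2 := by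
    filter_upwards [hK] with x hx
    rw [abs_of_nonneg (phaseVariance_nonneg κ b x)]
    refine (phaseVariance_le hκ b x).trans ?_
    gcongr
  obtain ⟨i3, b3⟩ := integral_abs_average_sub_le hN (measurable_phaseVariance (κ := κ) b) hb
  have h3 (k : Fin N) := integral_norm_sum_pow_three_le hK hmean (H k) (sum_sq_row_eq_one hH k)
  have i4 : Integrable (fun s : Fin N → ℂ =>
      16 * ‖b‖ ^ 3 * (∑ k, ‖∑ m, (H k m : ℂ) * s m‖ ^ 3) / (N * √N)) Q :=
    ((integrable_finsetSum _ fun k _ => (h3 k).1).const_mul _).div_const _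
  have b4 : ∫ s, 16 * ‖b‖ ^ 3 * (∑ k, ‖∑ m, (H k m : ℂ) * s m‖ ^ 3) / (N * √N) ∂Q ≤
      16 * ‖b‖ ^ 3 * (96 * Real.exp (K ^ 2 / 2)) / √N := by
    rw [integral_div, integral_const_mul, integral_finsetSum _ fun k _ => (h3 k).1]
    have : ∑ k, ∫ s, ‖∑ m, (H k m : ℂ) * s m‖ ^ 3 ∂Q ≤ N * (96 * Real.exp (K ^ 2 / 2)) := by
      calc _ ≤ ∑ k : Fin N, 96 * Real.exp (K ^ 2 / 2) := Finset.sum_le_sum fun k _ => (h3 k).2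
        _ = _ := by simp
    calc _ ≤ 16 * ‖b‖ ^ 3 * (N * (96 * Real.exp (K ^ 2 / 2))) / (N * √N) := by gcongr
      _ = _ := by field_simp
  rw [e, ← integral_sub i1 i2]
  refine (norm_integral_le_of_norm_le (i4.add i3) (ae_of_all _ fun s => ?_)).trans ?_
  · rw [mul_assoc, ← mul_sub, norm_mul, norm_exp_ofReal_mul_I, one_mul]
    exact norm_prod_charFun_rotated_sub_le hκ hN hH i hi b s hA
  · simp only [Pi.add_apply]
    rw [integral_add i4 i3, add_div]
    exact add_le_add b4 b3

end RotatedSums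

/-! ### Integration against the uniform law on the constellation -/

section UniformLaw

theorem integral_uniformOn_finset {E : Type*} [NormedAddCommGroup E] [NormedSpace ℝ E]
    [CompleteSpace E] (X : Finset ℂ) (f : ℂ → E) :
    ∫ x, f x ∂(uniformOn (X : Set ℂ)) = (X.card : ℝ)⁻¹ • ∑ x ∈ X, f x := by
  have h : IntegrableOn f (X : Set ℂ) Measure.count := by
    rw [← (X : Set ℂ).biUnion_of_singleton]
    simp [integrableOn_finset_iUnion]
  rw [uniformOn, ProbabilityTheory.cond, integral_smul_measure, setIntegral_finset _ h]
  simp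

theorem ae_mem_uniformOn (X : Finset ℂ) : ∀ᵐ x ∂(uniformOn (X : Set ℂ)), x ∈ X :=
  ae_cond_mem X.measurableSet

end UniformLaw

/-! ### Gaussian laws on the plane and circular symmetry -/

section ComplexGaussians

open Complex ComplexConjugate

theorem inner_sq_add_inner_I_mul_sq (z t : ℂ) :
    inner ℝ z t ^ 2 + inner ℝ (I * z) t ^ 2 = ‖z‖ ^ 2 * ‖t‖ ^ 2 := by
  rw [← normSq_eq_norm_sq, ← normSq_eq_norm_sq, Complex.inner, Complex.inner, normSq_apply,
    normSq_apply]
  simp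
  ring

/-- Only the quarter turn is needed: `z` and `I * z` have equal second moments along `t`, and these
add up to `v * ‖t‖ ^ 2`. -/
theorem charFun_of_isCircularlySymmetric {ν : Measure ℂ} {v : ℝ} (hν : IsComplexGaussian ν v)
    (hc : IsCircularlySymmetric ν) (t : ℂ) :
    charFun ν t = (Real.exp (-(v * ‖t‖ ^ 2 / 2) / 2) : ℂ) := by
  have := hν.isGaussian
  have hLp : MemLp (fun z : ℂ => z) 2 ν := IsGaussian.memLp_two_id
  have hint : Integrable (fun z : ℂ => z) ν := hLp.integrable (by norm_num)
  have hm : ∫ z, inner ℝ t z ∂ν = 0 := by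
    have := integral_inner (𝕜 := ℝ) hint t
    rw [this, hν.mean_eq, inner_zero_right]
  have hLpt (t : ℂ) : MemLp (fun z : ℂ => inner ℝ z t) 2 ν := hLp.inner_const t
  have hrot : ∫ z, inner ℝ z t ^ 2 ∂ν = ∫ z, inner ℝ (I * z) t ^ 2 ∂ν := by
    conv_lhs => rw [← hc (Real.pi / 2)]
    rw [integral_map (by fun_prop) (by fun_prop)]
    simp [Complex.exp_pi_div_two_mul_I]
  have hI : Integrable (fun z : ℂ => inner ℝ (I * z) t ^ 2) ν :=
    ((hLp.const_mul I).inner_const t).integrable_sq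
  have hsum : ∫ z, inner ℝ z t ^ 2 ∂ν + ∫ z, inner ℝ (I * z) t ^ 2 ∂ν = v * ‖t‖ ^ 2 := by
    rw [← integral_add (hLpt t).integrable_sq hI]
    simp only [inner_sq_add_inner_I_mul_sq]
    rw [integral_mul_const, hν.variance_eq]
  have hvar : Var[fun z : ℂ => inner ℝ t z; ν] = v * ‖t‖ ^ 2 / 2 := by
    rw [variance_of_integral_eq_zero (by fun_prop) hm]
    simp only [real_inner_comm _ t]
    linarith
  rw [IsGaussian.charFun_eq, hvar, integral_complex_ofReal, hm]
  push_cast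
  congr 1
  simp
  ring

/-- A centred Gaussian law on the plane with given covariance: that of `ρ` plus a multiple of the
identity. -/
theorem exists_isComplexGaussian {ρ : Measure ℂ} [IsProbabilityMeasure ρ] {K : ℝ}
    (hρ : ∀ᵐ w ∂ρ, ‖w‖ ≤ K) {v : ℝ} (hv : 0 ≤ v) :
    ∃ ν : Measure ℂ, IsComplexGaussian ν (v + ∫ w, ‖w‖ ^ 2 ∂ρ) ∧
      ∀ t, charFun ν t = (Real.exp (-(∫ w, inner ℝ w t ^ 2 ∂ρ + v * ‖t‖ ^ 2 / 2) / 2) : ℂ) := by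
  have hLp : MemLp (fun w : ℂ => w) 2 ρ := MemLp.of_bound (by fun_prop) K hρ
  have hre : MemLp (fun w : ℂ => w.re) 2 ρ := hLp.re
  have him : MemLp (fun w : ℂ => w.im) 2 ρ := hLp.im
  set c00 := ∫ w, w.re ^ 2 ∂ρ with h00
  set c01 := ∫ w, w.re * w.im ∂ρ
  set c11 := ∫ w, w.im ^ 2 ∂ρ with h11
  have i01 : Integrable (fun w : ℂ => w.re * w.im) ρ := hre.integrable_mul him
  have hquad (x y : ℝ) : ∫ w, (w.re * x + w.im * y) ^ 2 ∂ρ =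
      c00 * x ^ 2 + 2 * c01 * (x * y) + c11 * y ^ 2 := by
    have : ∀ w : ℂ, (w.re * x + w.im * y) ^ 2 =
        (w.re ^ 2 * x ^ 2 + w.re * w.im * (2 * (x * y))) + w.im ^ 2 * y ^ 2 := fun w => by ring
    simp only [this]
    have i0 : Integrable (fun w : ℂ => w.re ^ 2 * x ^ 2 + w.re * w.im * (2 * (x * y))) ρ :=
      (hre.integrable_sq.mul_const _).add (i01.mul_const _)
    rw [integral_add i0 (him.integrable_sq.mul_const _), integral_add (hre.integrable_sq.mul_const _)
      (i01.mul_const _), integral_mul_const, integral_mul_const, integral_mul_const]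
    ring
  -- The complex variance `v` is split equally between the two real components.
  set S : Matrix (Fin 2) (Fin 2) ℝ := !![c00 + v / 2, c01; c01, c11 + v / 2] with hS
  have hSq (x : Fin 2 → ℝ) : dotProduct x (S.mulVec x) =
      ∫ w, (w.re * x 0 + w.im * x 1) ^ 2 ∂ρ + v * (x 0 ^ 2 + x 1 ^ 2) / 2 := by
    rw [hquad]
    simp [hS, Matrix.mulVec, dotProduct, Fin.sum_univ_two]
    ring
  have hpos : S.PosSemidef := by
    refine Matrix.PosSemidef.of_dotProduct_mulVec_nonneg ?_ fun x => ?_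
    · ext i j
      fin_cases i <;> fin_cases j <;> simp [hS]
    · rw [star_trivial, hSq]
      have : 0 ≤ ∫ w, (w.re * x 0 + w.im * x 1) ^ 2 ∂ρ := integral_nonneg fun _ => sq_nonneg _
      positivity
  set γ := multivariateGaussian (0 : EuclideanSpace ℝ (Fin 2)) S with hγ
  set L := Complex.orthonormalBasisOneI.repr.symm.toContinuousLinearEquiv with hL
  have hLγ : MemLp (fun x : EuclideanSpace ℝ (Fin 2) => x) 2 γ := IsGaussian.memLp_two_id
  have hγm : ∫ x, x ∂γ = 0 := integral_id_multivariateGaussian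
  refine ⟨γ.map L, ⟨inferInstance, ?_, ?_⟩, fun t => ?_⟩
  · rw [integral_map (by fun_prop) (by fun_prop)]
    have := L.toContinuousLinearMap.integral_comp_comm (hLγ.integrable (by norm_num))
    rw [hγm, map_zero] at this
    exact this
  · rw [integral_map (by fun_prop) (by fun_prop)]
    have hn (x : EuclideanSpace ℝ (Fin 2)) : ‖L x‖ ^ 2 = x 0 ^ 2 + x 1 ^ 2 := by
      have : ‖L x‖ = ‖x‖ := Complex.orthonormalBasisOneI.repr.symm.norm_map x
      rw [this, EuclideanSpace.norm_sq_eq]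
      simp [Fin.sum_univ_two]
    simp only [hn]
    have hxi (i : Fin 2) : MemLp (fun x : EuclideanSpace ℝ (Fin 2) => x i) 2 γ :=
      (EuclideanSpace.proj (𝕜 := ℝ) i).comp_memLp' hLγ
    have hxm (i : Fin 2) : ∫ x, x i ∂γ = 0 := by
      have := (EuclideanSpace.proj (𝕜 := ℝ) i).integral_comp_comm (hLγ.integrable (by norm_num))
      rw [hγm, map_zero] at this
      exact this
    have hxv (i : Fin 2) : ∫ x, x i ^ 2 ∂γ = S i i := by
      rw [← variance_eval_multivariateGaussian hpos i (μ := 0),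
        variance_of_integral_eq_zero (by fun_prop) (hxm i)]
    rw [integral_add (hxi 0).integrable_sq (hxi 1).integrable_sq, hxv, hxv]
    have : ∫ w : ℂ, ‖w‖ ^ 2 ∂ρ = c00 + c11 := by
      rw [h00, h11, ← integral_add hre.integrable_sq him.integrable_sq]
      congr 1
      ext w
      rw [← normSq_eq_norm_sq, normSq_apply]
      ring
    rw [this]
    simp [hS]
    ring
  · have : charFun (γ.map L) t = charFun γ (Complex.orthonormalBasisOneI.repr t) := by
      rw [charFun_apply, charFun_apply, integral_map (by fun_prop) (by fun_prop)]
      congr 1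
      ext x
      congr 3
      exact (Complex.orthonormalBasisOneI.repr.symm.inner_map_eq_flip x t)
    rw [this, hγ, charFun_multivariateGaussian hpos, hSq]
    have h0 : (Complex.orthonormalBasisOneI.repr t).ofLp 0 = t.re := by simp
    have h1 : (Complex.orthonormalBasisOneI.repr t).ofLp 1 = t.im := by simp
    have hi (w : ℂ) : inner ℝ w t = w.re * t.re + w.im * t.im := by
      rw [Complex.inner]; simp; ring
    rw [h0, h1, ← normSq_eq_norm_sq, normSq_apply]
    simp only [hi]
    push_cast
    congr 1
    simp
    ring

theorem isCircularlySymmetric_of_charFun {ν : Measure ℂ} [IsFiniteMeasure ν] {f : ℝ → ℂ}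
    (h : ∀ t, charFun ν t = f ‖t‖) : IsCircularlySymmetric ν := by
  intro φ
  have hm : Measurable fun z : ℂ => exp (φ * I) * z := by fun_prop
  refine Measure.ext_of_charFun (funext fun t => ?_)
  have : charFun (ν.map fun z => exp (φ * I) * z) t = charFun ν (conj (exp (φ * I)) * t) := by
    rw [charFun_apply, charFun_apply, integral_map hm.aemeasurable (by fun_prop)]
    congr 1
    ext z
    rw [inner_conj_mul, mul_comm z]
  rw [this, h, h, norm_mul, RCLike.norm_conj, norm_exp_ofReal_mul_I, one_mul]

end ComplexGaussians

/-! ### Covariance of the limiting noise -/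

section PhaseVariance

open Complex ComplexConjugate

variable {κ μ : Measure ℂ} [IsProbabilityMeasure κ] [IsProbabilityMeasure μ] {K : ℝ}

theorem integral_norm_sub_mean_sq (hκ : ∀ᵐ z ∂κ, ‖z‖ = 1) :
    ∫ z, ‖z - ∫ w, w ∂κ‖ ^ 2 ∂κ = 1 - ‖∫ w, w ∂κ‖ ^ 2 := by
  set m := ∫ w, w ∂κ with hm
  have hint : Integrable (fun z : ℂ => z) κ :=
    Integrable.of_bound (by fun_prop) 1 (hκ.mono fun _ h => h.le)
  have h : ∫ z, ‖z - m‖ ^ 2 ∂κ = ∫ z, (1 + ‖m‖ ^ 2 - 2 * inner ℝ m z) ∂κ := by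
    refine integral_congr_ae ?_
    filter_upwards [hκ] with z hz
    rw [norm_sub_sq_real, hz, real_inner_comm]
    ring
  have hi : Integrable (fun z : ℂ => 2 * inner ℝ m z) κ := (hint.const_inner m).const_mul 2
  rw [h, integral_sub (integrable_const _) hi, integral_const_mul,
    integral_inner (𝕜 := ℝ) hint m, ← hm, real_inner_self_eq_norm_sq]
  simp
  ring

/-- The Gaussian law of the total noise: phase noise contribution and additive noise. -/
theorem exists_isComplexGaussian_phaseVariance (hκ : ∀ᵐ z ∂κ, ‖z‖ = 1) (hK : ∀ᵐ x ∂μ, ‖x‖ ≤ K)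
    {v : ℝ} (hv : 0 ≤ v) :
    ∃ ν : Measure ℂ,
      IsComplexGaussian ν (v + (∫ x, ‖x‖ ^ 2 ∂μ) * (1 - ‖∫ w, w ∂κ‖ ^ 2)) ∧
      ∀ t, charFun ν t =
        (Real.exp (-(∫ x, phaseVariance κ t x ∂μ + v * ‖t‖ ^ 2 / 2) / 2) : ℂ) := by
  have hκ1 : ∀ᵐ z ∂κ, ‖z‖ ≤ 1 := hκ.mono fun _ h => h.le
  set m := ∫ w, w ∂κ
  have hf : Measurable fun p : ℂ × ℂ => (p.2 - m) * p.1 := by fun_prop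
  -- The law of the centred phase factor times an independent symbol: its second moment along `t` is
  -- the symbol average of `phaseVariance κ t`.
  set ρ := (μ.prod κ).map fun p : ℂ × ℂ => (p.2 - m) * p.1
  have : IsProbabilityMeasure ρ := Measure.isProbabilityMeasure_map hf.aemeasurable
  have hb : ∀ᵐ p ∂(μ.prod κ), ‖(p.2 - m) * p.1‖ ≤ 2 * K := by
    filter_upwards [Measure.quasiMeasurePreserving_fst.ae hK,
      Measure.quasiMeasurePreserving_snd.ae hκ1] with p h1 h2
    rw [norm_mul]
    have : ‖p.2 - m‖ ≤ 2 := (norm_sub_le _ _).trans (by linarith [norm_integral_le_one hκ1])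
    gcongr
  have hρ : ∀ᵐ w ∂ρ, ‖w‖ ≤ 2 * K :=
    (ae_map_iff hf.aemeasurable (measurableSet_le (by fun_prop) (by fun_prop))).mpr hb
  obtain ⟨ν, hν, hch⟩ := exists_isComplexGaussian hρ hv
  refine ⟨ν, ?_, fun t => ?_⟩
  · convert hν using 2
    rw [integral_map hf.aemeasurable (by fun_prop)]
    simp only [norm_mul, mul_pow]
    have := integral_prod_mul (μ := μ) (ν := κ) (fun x => ‖x‖ ^ 2) fun z => ‖z - m‖ ^ 2
    simp only [mul_comm (‖_ - m‖ ^ 2)]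
    rw [this, integral_norm_sub_mean_sq hκ]
  · rw [hch, integral_map hf.aemeasurable (by fun_prop), integral_prod]
    · rfl
    · refine Integrable.of_bound (Continuous.aestronglyMeasurable (by fun_prop))
        ((2 * K * ‖t‖) ^ 2) ?_
      filter_upwards [hb] with p hp
      rw [Real.norm_eq_abs, abs_of_nonneg (sq_nonneg _), ← sq_abs]
      gcongr
      exact (abs_real_inner_le_norm _ _).trans (by gcongr)

/-- For a constellation that is invariant under the rotation by a right angle the phase noise
contribution has no preferred direction. -/
theorem integral_phaseVariance_of_rotation_invariant (hκ : ∀ᵐ z ∂κ, ‖z‖ = 1) {X : Finset ℂ}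
    (hX : ∀ x ∈ X, I * x ∈ X) (t : ℂ) :
    ∫ x, phaseVariance κ t x ∂(uniformOn (X : Set ℂ)) =
      ((X.card : ℝ)⁻¹ * ((1 - ‖∫ w, w ∂κ‖ ^ 2) * ∑ x ∈ X, ‖x‖ ^ 2) / 2) * ‖t‖ ^ 2 := by
  have hκ1 : ∀ᵐ z ∂κ, ‖z‖ ≤ 1 := hκ.mono fun _ h => h.le
  have himg : X.image (I * ·) = X := by
    refine Finset.eq_of_subset_of_card_le (Finset.image_subset_iff.mpr hX) ?_
    rw [Finset.card_image_of_injective _ (mul_right_injective₀ I_ne_zero)]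
  have hrot : ∑ x ∈ X, phaseVariance κ t x = ∑ x ∈ X, phaseVariance κ t (I * x) := by
    conv_lhs => rw [← himg]
    rw [Finset.sum_image ((mul_right_injective₀ I_ne_zero).injOn)]
  -- Components along `t` of a vector and of its quarter turn obey Pythagoras, so averaging `x` with
  -- `I * x` removes the direction of `t`.
  have hadd (x : ℂ) : phaseVariance κ t x + phaseVariance κ t (I * x) =
      (1 - ‖∫ w, w ∂κ‖ ^ 2) * ‖x‖ ^ 2 * ‖t‖ ^ 2 := by
    rw [phaseVariance, phaseVariance,
      ← integral_add (integrable_inner_sq hκ1 t x) (integrable_inner_sq hκ1 t _),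
      ← integral_norm_sub_mean_sq hκ, ← integral_mul_const, ← integral_mul_const]
    congr 1
    ext z
    rw [mul_left_comm, inner_sq_add_inner_I_mul_sq, norm_mul, mul_pow]
  have hsum : ∑ x ∈ X, phaseVariance κ t x + ∑ x ∈ X, phaseVariance κ t (I * x) =
      (1 - ‖∫ w, w ∂κ‖ ^ 2) * (∑ x ∈ X, ‖x‖ ^ 2) * ‖t‖ ^ 2 := by
    rw [← Finset.sum_add_distrib, Finset.mul_sum, Finset.sum_mul]
    exact Finset.sum_congr rfl fun x _ => hadd x
  rw [integral_uniformOn_finset, smul_eq_mul]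
  have : ∑ x ∈ X, phaseVariance κ t x =
      (1 - ‖∫ w, w ∂κ‖ ^ 2) * (∑ x ∈ X, ‖x‖ ^ 2) * ‖t‖ ^ 2 / 2 := by linarith
  rw [this]
  ring

end PhaseVariance

/-! ### Quarter-turn invariance of QAM constellations -/

section QAM

open Complex

theorem I_mul_mem_squareQAM {m : ℕ} {z : ℂ} (hz : z ∈ squareQAM m) : I * z ∈ squareQAM m := by
  simp only [squareQAM, Finset.mem_image, Finset.mem_univ, true_and, Prod.exists] at hz ⊢
  obtain ⟨p, q, rfl⟩ := hz
  -- As `I * (x + I * y) = -y + I * x`, the grid indices are swapped and one is reversed.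
  refine ⟨q.rev, p, ?_⟩
  have hq : ((q.rev : ℕ) : ℝ) = m - 1 - q := by
    rw [Fin.val_rev, Nat.cast_sub (by omega)]
    push_cast
    ring
  rw [hq]
  push_cast
  linear_combination (-(2 * (q : ℂ) - (m - 1))) * I_mul_I

theorem I_mul_mem_crossQAM {c : ℕ} {z : ℂ} (hz : z ∈ crossQAM c) : I * z ∈ crossQAM c := by
  simp only [crossQAM, Finset.mem_filter] at hz ⊢
  refine ⟨I_mul_mem_squareQAM hz.1, ?_⟩
  simpa [or_comm] using hz.2

theorem IsStandardQAM.I_mul_mem {X : Finset ℂ} (hX : IsStandardQAM X) : ∀ x ∈ X, I * x ∈ X := by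
  obtain ⟨a, -, ⟨m, -, rfl⟩ | ⟨c, -, rfl⟩⟩ := hX
  all_goals
    intro x hx
    rw [Finset.mem_image] at hx ⊢
    obtain ⟨z, hz, rfl⟩ := hx
  · exact ⟨I * z, I_mul_mem_squareQAM hz, mul_left_comm _ _ _⟩
  · exact ⟨I * z, I_mul_mem_crossQAM hz, mul_left_comm _ _ _⟩

end QAM

/-! ### The law of the phase factor `e^{jθ}` -/

section PhaseLaw

open Complex ComplexConjugate

/-- The law of `e^{jθ}` for a centred Gaussian phase `θ` with variance `v`. -/
noncomputable def phaseLaw (v : ℝ≥0) : Measure ℂ :=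
  (gaussianReal 0 v).map fun θ : ℝ => exp (θ * I)

theorem measurable_exp_ofReal_mul_I : Measurable fun θ : ℝ => exp (θ * I) := by fun_prop

instance (v : ℝ≥0) : IsProbabilityMeasure (phaseLaw v) :=
  Measure.isProbabilityMeasure_map measurable_exp_ofReal_mul_I.aemeasurable

theorem ae_phaseLaw_norm_eq_one (v : ℝ≥0) : ∀ᵐ z ∂(phaseLaw v), ‖z‖ = 1 :=
  (ae_map_iff measurable_exp_ofReal_mul_I.aemeasurable
    (measurableSet_eq_fun measurable_norm measurable_const)).mpr
    (ae_of_all _ fun θ => norm_exp_ofReal_mul_I θ)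

theorem integral_phaseLaw (v : ℝ≥0) : ∫ z, z ∂(phaseLaw v) = (Real.exp (-v / 2) : ℂ) := by
  rw [phaseLaw, integral_map measurable_exp_ofReal_mul_I.aemeasurable (by fun_prop)]
  have := charFun_gaussianReal (μ := 0) (v := v) 1
  rw [charFun_apply_real] at this
  simp only [ofReal_one, one_mul] at this
  rw [this]
  push_cast
  congr 1
  simp
  ring

theorem norm_integral_phaseLaw_sq (v : ℝ≥0) : ‖∫ z, z ∂(phaseLaw v)‖ ^ 2 = Real.exp (-v) := by
  rw [integral_phaseLaw, norm_real, Real.norm_eq_abs, sq_abs, ← Real.exp_nat_mul]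
  congr 1
  push_cast
  ring

end PhaseLaw

/-! ### Joint characteristic function in the channel model -/

section Model

open Complex ComplexConjugate

variable {X : Finset ℂ} {σp2 N0 : ℝ≥0} {Ω : Type*} [MeasurableSpace Ω] {P : Measure Ω}
  {N : ℕ} {s : Fin N → Ω → ℂ} {θ : Fin N → Ω → ℝ} {n : Fin N → Ω → ℂ}

theorem IsPhaseNoiseModel.aemeasurable_noise (h : IsPhaseNoiseModel X σp2 N0 P s θ n)
    (k : Fin N) : AEMeasurable (n k) P := by
  have := (h.noise_gaussian k).isGaussian
  exact AEMeasurable.of_map_ne_zero (IsProbabilityMeasure.ne_zero _)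

theorem IsPhaseNoiseModel.map_eq_prod [IsProbabilityMeasure P]
    (h : IsPhaseNoiseModel X σp2 N0 P s θ n) :
    P.map (fun ω => ((fun k => s k ω), ((fun k => θ k ω), fun k => n k ω))) =
      (Measure.pi fun _ => uniformOn (X : Set ℂ)).prod
        ((Measure.pi fun _ => gaussianReal 0 σp2).prod (Measure.pi fun k => P.map (n k))) := by
  have hs k : AEMeasurable (s k) P := (h.symbol_law k).aemeasurable
  have hθ k : AEMeasurable (θ k) P := (h.phase_law k).aemeasurable
  have hn k : AEMeasurable (n k) P := h.aemeasurable_noise k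
  have hs' : AEMeasurable (fun ω k => s k ω) P := aemeasurable_pi_lambda _ hs
  have hθ' : AEMeasurable (fun ω k => θ k ω) P := aemeasurable_pi_lambda _ hθ
  have hn' : AEMeasurable (fun ω k => n k ω) P := aemeasurable_pi_lambda _ hn
  rw [(indepFun_iff_map_prod_eq_prod_map_map hs' (hθ'.prodMk hn')).mp h.symbol_indep_rest,
    (indepFun_iff_map_prod_eq_prod_map_map hθ' hn').mp h.phase_indep_noise,
    (iIndepFun_iff_map_fun_eq_pi_map hs).mp h.symbol_indep,
    (iIndepFun_iff_map_fun_eq_pi_map hθ).mp h.phase_indep,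
    (iIndepFun_iff_map_fun_eq_pi_map hn).mp h.noise_indep]
  simp only [(h.symbol_law _).map_eq, (h.phase_law _).map_eq]

theorem exp_inner_sum_mul_I {ι : Type*} [Fintype ι] (z : ι → ℂ) (b : ℂ) :
    exp (inner ℝ (∑ k, z k) b * I) = ∏ k, exp (inner ℝ (z k) b * I) := by
  rw [← exp_sum, sum_inner, ofReal_sum, Finset.sum_mul]

theorem integral_exp_inner_phase (σp2 : ℝ≥0) (w : Fin N → ℂ) (b : ℂ) :
    ∫ θ, exp (inner ℝ (∑ k, exp ((θ k : ℝ) * I) * w k) b * I)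
      ∂(Measure.pi fun _ : Fin N => gaussianReal 0 σp2) =
    ∏ k, charFun (phaseLaw σp2) (conj (w k) * b) := by
  simp only [exp_inner_sum_mul_I]
  rw [integral_fintype_prod_eq_prod (fun k (θ : ℝ) => exp (inner ℝ (exp (θ * I) * w k) b * I))]
  refine Finset.prod_congr rfl fun k _ => ?_
  rw [charFun_apply, phaseLaw,
    integral_map measurable_exp_ofReal_mul_I.aemeasurable (by fun_prop)]
  simp only [inner_conj_mul]

/-- By circular symmetry each factor depends only on the modulus of its coefficient, so the
exponents add with weights `c k ^ 2` of total one: derotation leaves the noise law in a channel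
unchanged. -/
theorem integral_exp_inner_noise {ν : Fin N → Measure ℂ} {v : ℝ}
    (hν : ∀ k, IsComplexGaussian (ν k) v) (hc : ∀ k, IsCircularlySymmetric (ν k))
    (c : Fin N → ℝ) (hc1 : ∑ k, c k ^ 2 = 1) {u : ℂ} (hu : ‖u‖ = 1) (b : ℂ) :
    ∫ n, exp (inner ℝ (∑ k, (c k : ℂ) * (u * n k)) b * I) ∂(Measure.pi ν) =
      (Real.exp (-(v * ‖b‖ ^ 2 / 2) / 2) : ℂ) := by
  have (k : Fin N) : IsGaussian (ν k) := (hν k).isGaussian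
  simp only [exp_inner_sum_mul_I]
  rw [integral_fintype_prod_eq_prod (fun k (z : ℂ) => exp (inner ℝ ((c k : ℂ) * (u * z)) b * I))]
  have h (k : Fin N) : ∫ z, exp (inner ℝ ((c k : ℂ) * (u * z)) b * I) ∂(ν k) =
      ((Real.exp (-(v * ‖b‖ ^ 2 / 2) / 2 * c k ^ 2) : ℝ) : ℂ) := by
    have := charFun_of_isCircularlySymmetric (hν k) (hc k) (conj ((c k : ℂ) * u) * b)
    rw [charFun_apply] at this
    simp only [inner_conj_mul, norm_mul, RCLike.norm_conj, norm_real, hu, mul_one] at this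
    simp only [← mul_assoc, mul_comm _ ((c k : ℂ) * u)] at this ⊢
    rw [this, mul_pow, Real.norm_eq_abs, sq_abs]
    congr 2
    ring
  simp only [h]
  rw [← ofReal_prod, ← Real.exp_sum, ← Finset.mul_sum, hc1, mul_one]

/-- The joint characteristic function of a symbol and of the received signal after derotation. -/
theorem IsPhaseNoiseModel.integral_exp_inner [IsProbabilityMeasure P]
    (h : IsPhaseNoiseModel X σp2 N0 P s θ n)
    {H : Matrix (Fin N) (Fin N) ℝ} (hH : H.transpose * H = 1) (i : Fin N) {u : ℂ} (hu : ‖u‖ = 1)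
    (a b : ℂ) :
    ∫ ω, exp (inner ℝ (s i ω) a * I) * exp (inner ℝ
        (∑ k, (H k i : ℂ) * (exp (θ k ω * I) * ∑ m, (H k m : ℂ) * s m ω) +
          ∑ k, (H k i : ℂ) * (u * n k ω)) b * I) ∂P =
    (∫ x, exp (inner ℝ (x i) a * I) *
      ∏ k, charFun (phaseLaw σp2) (conj ((H k i : ℂ) * ∑ m, (H k m : ℂ) * x m) * b)
        ∂(Measure.pi fun _ : Fin N => uniformOn (X : Set ℂ))) *
      (Real.exp (-(N0 * ‖b‖ ^ 2 / 2) / 2) : ℂ) := by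
  have hμ : IsProbabilityMeasure (uniformOn (X : Set ℂ)) :=
    (h.symbol_law i).isProbabilityMeasure_iff.mp inferInstance
  have hν (k : Fin N) : IsGaussian (P.map (n k)) := (h.noise_gaussian k).isGaussian
  set G : (Fin N → ℂ) × (Fin N → ℝ) × (Fin N → ℂ) → ℂ := fun p =>
    exp (inner ℝ (p.1 i) a * I) * exp (inner ℝ
        (∑ k, (H k i : ℂ) * (exp (p.2.1 k * I) * ∑ m, (H k m : ℂ) * p.1 m) +
          ∑ k, (H k i : ℂ) * (u * p.2.2 k)) b * I) with hG
  have hGc : Continuous G := by fun_prop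
  have hae : AEMeasurable
      (fun ω => ((fun k => s k ω), ((fun k => θ k ω), fun k => n k ω))) P :=
    (aemeasurable_pi_lambda _ fun k => (h.symbol_law k).aemeasurable).prodMk
      ((aemeasurable_pi_lambda _ fun k => (h.phase_law k).aemeasurable).prodMk
        (aemeasurable_pi_lambda _ fun k => h.aemeasurable_noise k))
  have hmap := integral_map hae (f := G) hGc.aestronglyMeasurable
  rw [h.map_eq_prod] at hmap
  rw [← hmap, integral_prod _ (Integrable.of_bound hGc.aestronglyMeasurable 1
    (ae_of_all _ fun p => by
      rw [hG, norm_mul, norm_exp_ofReal_mul_I, norm_exp_ofReal_mul_I, one_mul])),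
    ← integral_mul_const]
  congr 1
  ext x
  have hcol : ∑ k, H k i ^ 2 = 1 := by
    have := congrFun (congrFun hH i) i
    simpa [Matrix.mul_apply, ← sq] using this
  simp only [hG, integral_const_mul, inner_add_left, ofReal_add, add_mul, exp_add, mul_assoc]
  congr 1
  rw [integral_prod_mul (fun t : Fin N → ℝ => exp (inner ℝ
        (∑ k, (H k i : ℂ) * (exp (t k * I) * ∑ m, (H k m : ℂ) * x m)) b * I))
    (fun z : Fin N → ℂ => exp (inner ℝ (∑ k, (H k i : ℂ) * (u * z k)) b * I)),
    integral_exp_inner_noise h.noise_gaussian h.noise_circular _ hcol hu]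
  congr 1
  simp only [mul_left_comm _ (exp _) _]
  exact integral_exp_inner_phase σp2 _ b

end Model

/-! ### Lévy's continuity theorem for pairs -/

section Convergence

open Complex

/-- Lévy's theorem for pairs of complex random variables. -/
theorem tendstoInDistribution_pair_of_charFun {Ω : ℕ → Type*} [∀ ℓ, MeasurableSpace (Ω ℓ)]
    {P : ∀ ℓ, Measure (Ω ℓ)} [∀ ℓ, IsProbabilityMeasure (P ℓ)] {Ω' : Type*} [MeasurableSpace Ω']
    {P' : Measure Ω'} [IsProbabilityMeasure P'] {Y Z : ∀ ℓ, Ω ℓ → ℂ} {Y' Z' : Ω' → ℂ}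
    (hY : ∀ ℓ, AEMeasurable (Y ℓ) (P ℓ)) (hZ : ∀ ℓ, AEMeasurable (Z ℓ) (P ℓ))
    (hY' : AEMeasurable Y' P') (hZ' : AEMeasurable Z' P')
    (h : ∀ a b : ℂ, Tendsto
      (fun ℓ => ∫ ω, exp (inner ℝ (Y ℓ ω) a * I) * exp (inner ℝ (Z ℓ ω) b * I) ∂(P ℓ)) atTop
      (nhds (∫ ω, exp (inner ℝ (Y' ω) a * I) * exp (inner ℝ (Z' ω) b * I) ∂P'))) :
    TendstoInDistribution (fun ℓ ω => (Y ℓ ω, Z ℓ ω)) atTop (fun ω => (Y' ω, Z' ω)) P P' := by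
  -- The plain product carries the sup norm; characteristic functions are taken on the Euclidean
  -- product, and the result is transported back by continuity.
  have hc : Continuous (WithLp.toLp 2 : ℂ × ℂ → WithLp 2 (ℂ × ℂ)) := by fun_prop
  have hm (ℓ : ℕ) : AEMeasurable (fun ω => WithLp.toLp 2 (Y ℓ ω, Z ℓ ω)) (P ℓ) :=
    hc.measurable.comp_aemeasurable ((hY ℓ).prodMk (hZ ℓ))
  have hm' : AEMeasurable (fun ω => WithLp.toLp 2 (Y' ω, Z' ω)) P' :=
    hc.measurable.comp_aemeasurable (hY'.prodMk hZ')
  have key : TendstoInDistribution (fun ℓ ω => WithLp.toLp 2 (Y ℓ ω, Z ℓ ω)) atTop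
      (fun ω => WithLp.toLp 2 (Y' ω, Z' ω)) P P' := by
    refine ⟨hm, hm', ProbabilityMeasure.tendsto_iff_tendsto_charFun.mpr fun t => ?_⟩
    have e (y z : ℂ) : exp (inner ℝ (WithLp.toLp 2 (y, z)) t * I) =
        exp (inner ℝ y t.fst * I) * exp (inner ℝ z t.snd * I) := by
      rw [WithLp.prod_inner_apply, ofReal_add, add_mul, exp_add]
      rfl
    convert h t.fst t.snd using 2
    · rename_i ℓ
      simp only [ProbabilityMeasure.coe_mk, charFun_apply]
      rw [integral_map (hm ℓ) (by fun_prop)]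
      simp only [e]
    · simp only [ProbabilityMeasure.coe_mk, charFun_apply]
      rw [integral_map hm' (by fun_prop)]
      simp only [e]
  exact key.continuous_comp (g := WithLp.ofLp) (by fun_prop)

end Convergence

/-! ### Construction of the limit and conclusion -/

theorem proposition1
    (X : Finset ℂ) (hX : X.Nonempty) (hmean : ∑ x ∈ X, x = 0)
    (Es : ℝ) (hEs : (∑ x ∈ X, ‖x‖ ^ 2) / (X.card : ℝ) = Es) (σp2 N0 : ℝ≥0) :
    ∃ (Ω' : Type) (_ : MeasurableSpace Ω') (P' : Measure Ω') (_ : IsProbabilityMeasure P')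
      (s' n' : Ω' → ℂ),
      HasLaw s' (uniformOn (X : Set ℂ)) P' ∧
      IndepFun s' n' P' ∧
      IsComplexGaussian (P'.map n') (N0 + Es * (1 - Real.exp (-σp2))) ∧
      (IsStandardQAM X → IsCircularlySymmetric (P'.map n')) ∧
      ∀ (Ω : ℕ → Type*) [∀ ℓ, MeasurableSpace (Ω ℓ)]
        (P : ∀ ℓ, Measure (Ω ℓ)) [∀ ℓ, IsProbabilityMeasure (P ℓ)]
        (s : ∀ ℓ, Fin (2 ^ ℓ) → Ω ℓ → ℂ) (θ : ∀ ℓ, Fin (2 ^ ℓ) → Ω ℓ → ℝ)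
        (n : ∀ ℓ, Fin (2 ^ ℓ) → Ω ℓ → ℂ)
        (R : ∀ ℓ, Matrix (Fin (2 ^ ℓ * 2)) (Fin (2 ^ ℓ * 2)) ℝ)
        (i : ∀ ℓ, Fin (2 ^ ℓ)),
        (∀ ℓ, IsPhaseNoiseModel X σp2 N0 (P ℓ) (s ℓ) (θ ℓ) (n ℓ)) →
        (∀ ℓ, IsHadamardRotation ℓ (R ℓ)) →
        TendstoInDistribution
          (fun ℓ ω => (s ℓ (i ℓ) ω,
            derotatedSignal (R ℓ) (fun k => s ℓ k ω) (fun k => θ ℓ k ω) (fun k => n ℓ k ω) (i ℓ)))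
          atTop
          (fun ω' => (s' ω', (Real.exp (-σp2 / 2) : ℂ) * s' ω' + n' ω'))
          P P' := by
  set μ := uniformOn (X : Set ℂ) with hμ
  have hμp : IsProbabilityMeasure μ := isProbabilityMeasure_uniformOn X.finite_toSet hX
  obtain ⟨K, hK⟩ : ∃ K : ℝ, ∀ x ∈ X, ‖x‖ ≤ K :=
    ⟨∑ x ∈ X, ‖x‖, fun x hx =>
      Finset.single_le_sum (f := fun x : ℂ => ‖x‖) (fun _ _ => norm_nonneg _) hx⟩
  have hKμ : ∀ᵐ x ∂μ, ‖x‖ ≤ K := (ae_mem_uniformOn X).mono hK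
  have hμ0 : ∫ x, x ∂μ = 0 := by rw [hμ, integral_uniformOn_finset, hmean, smul_zero]
  have hμ2 : ∫ x, ‖x‖ ^ 2 ∂μ = Es := by
    rw [hμ, integral_uniformOn_finset, ← hEs, smul_eq_mul, inv_mul_eq_div]
  have hκ := ae_phaseLaw_norm_eq_one σp2
  obtain ⟨ν, hν, hch⟩ := exists_isComplexGaussian_phaseVariance hκ hKμ N0.coe_nonneg
  rw [hμ2, norm_integral_phaseLaw_sq] at hν
  have hνp : IsProbabilityMeasure ν := have := hν.isGaussian; inferInstance
  have hsnd : (μ.prod ν).map Prod.snd = ν := by simp [Measure.map_snd_prod]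
  -- The limit lives on a product space, chosen before any channel or rotation and hence the same
  -- for all of them.
  refine ⟨ℂ × ℂ, inferInstance, μ.prod ν, inferInstance, Prod.fst, Prod.snd,
    ⟨by fun_prop, by simp [Measure.map_fst_prod]⟩,
    indepFun_prod measurable_id measurable_id, by rwa [hsnd], fun hQAM => ?_, ?_⟩
  · rw [hsnd]
    refine isCircularlySymmetric_of_charFun (f := fun r => (Real.exp (-(
      ((X.card : ℝ)⁻¹ * ((1 - ‖∫ w, w ∂(phaseLaw σp2)‖ ^ 2) * ∑ x ∈ X, ‖x‖ ^ 2) / 2) * r ^ 2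
        + N0 * r ^ 2 / 2) / 2) : ℂ)) fun t => ?_
    rw [hch, hμ, integral_phaseVariance_of_rotation_invariant hκ hQAM.I_mul_mem]
  intro Ω _ P _ s θ n R i hmodel hR
  choose u hu hder using fun ℓ => (hR ℓ).exists_derotatedSignal_eq
  simp only [hder]
  have hs ℓ k : AEMeasurable (s ℓ k) (P ℓ) := ((hmodel ℓ).symbol_law k).aemeasurable
  have hθ ℓ k : AEMeasurable (θ ℓ k) (P ℓ) := ((hmodel ℓ).phase_law k).aemeasurable
  have hn ℓ k : AEMeasurable (n ℓ k) (P ℓ) := (hmodel ℓ).aemeasurable_noise k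
  refine tendstoInDistribution_pair_of_charFun (fun ℓ => hs ℓ _) (fun ℓ => ?_) (by fun_prop)
    (by fun_prop) fun a b => ?_
  · refine (Finset.aemeasurable_fun_sum _ fun k _ => ?_).add
      (Finset.aemeasurable_fun_sum _ fun k _ => ((hn ℓ k).const_mul _).const_mul _)
    refine AEMeasurable.const_mul (AEMeasurable.mul ?_ ?_) _
    · exact measurable_exp_ofReal_mul_I.comp_aemeasurable (hθ ℓ k)
    · exact Finset.aemeasurable_fun_sum _ fun m _ => (hs ℓ m).const_mul _
  have hlim : ∫ ω : ℂ × ℂ, Complex.exp (inner ℝ ω.1 a * Complex.I) *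
      Complex.exp (inner ℝ ((Real.exp (-σp2 / 2) : ℂ) * ω.1 + ω.2) b * Complex.I) ∂(μ.prod ν) =
      (∫ x, Complex.exp (inner ℝ x a * Complex.I) *
        Complex.exp (inner ℝ ((∫ z, z ∂(phaseLaw σp2)) * x) b * Complex.I) ∂μ) *
      (Real.exp (-(∫ x, phaseVariance (phaseLaw σp2) b x ∂μ) / 2) : ℂ) *
      (Real.exp (-(N0 * ‖b‖ ^ 2 / 2) / 2) : ℂ) := by
    simp only [inner_add_left, Complex.ofReal_add, add_mul, Complex.exp_add, ← mul_assoc]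
    rw [integral_prod_mul (fun x : ℂ => Complex.exp (inner ℝ x a * Complex.I) *
        Complex.exp (inner ℝ ((Real.exp (-σp2 / 2) : ℂ) * x) b * Complex.I))
      (fun z : ℂ => Complex.exp (inner ℝ z b * Complex.I)), ← charFun_apply, hch,
      integral_phaseLaw, mul_assoc, neg_add, add_div, Real.exp_add, Complex.ofReal_mul]
  rw [hlim]
  simp only [fun ℓ => (hmodel ℓ).integral_exp_inner (hadamard_transpose_mul ℓ) (i ℓ) (hu ℓ) a b]
  -- The additive noise contributes exactly the same Gaussian factor for every `ℓ` and in the limit;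
  -- only the phase noise part has to converge.
  refine Tendsto.mul_const _ ?_
  rw [tendsto_iff_norm_sub_tendsto_zero]
  have hbound (ℓ : ℕ) := norm_integral_charFun_sub_le (hκ.mono fun _ h => h.le) hKμ hμ0
    (N := 2 ^ ℓ) (by positivity) (hadamard_transpose_mul ℓ) (i ℓ)
    (fun k => by rw [hadamard_sq]; push_cast; rfl) a b
  refine squeeze_zero (fun ℓ => norm_nonneg _) hbound ?_
  refine Tendsto.div_atTop tendsto_const_nhds ?_
  refine Real.tendsto_sqrt_atTop.comp (tendsto_natCast_atTop_atTop.comp ?_)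
  exact tendsto_pow_atTop_atTop_of_one_lt (by norm_num)
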